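/- Let $M=(\mathcal S,\mathcal A,P,r,\gamma)$ be a discounted Markov decision process with finite nonempty state and action sets, rewards $r(s,a)\in[0,1]$ and discount factor $\gamma\in(0,1)$. For a policy $\pi:\mathcal S\to\mathcal A$ let $v^\pi(s)=\mathbb E\big[\sum_{t\ge0}\gamma^t r(s^t,\pi(s^t))\mid s^0=s\big]$ and $v^*(s)=\max_\pi v^\pi(s)$; $\pi$ is $\epsilon$-optimal from every initial state if $v^\pi(s)\ge v^*(s)-\epsilon$ for all $s$. Suppose that $M$ admits the linear feature representation $\phi:\mathcal S\times\mathcal A\to\mathbb R^d$, i.e. $P(s'|s,a)=\sum_{l}\phi_l(s,a)\psi_l(s')$ for some functions $\psi_l:\mathcal S\to\mathbb R$, and that there are $K$ anchor state-action pairs $(s_1,a_1),\dots,(s_K,a_K)$ and coefficients $\lambda_k(s,a)\ge0$, $\sum_k\lambda_k(s,a)=1$, with $\phi(s,a)=\sum_{k}\lambda_k(s,a)\,\phi(s_k,a_k)$ for all $(s,a)$. (When the anchors have unit feature vectors, $\lambda=\phi$.) Let $\epsilon,\delta\in(0,1)$. For a finite nonempty set $\theta\subset\mathbb R^K$ let $V_\theta(s)=\max_{w\in\theta}\max_a\big(r(s,a)+\gamma\lambda(s,a)^\top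 w\big)$, and let $\pi_\theta$ be any policy with $\pi_\theta(s)\in\arg\max_a\max_{w\in\theta}\big(r(s,a)+\gamma\lambda(s,a)^\top w\big)$. Algorithm (OPPQ-Learning), with positive constants $c_1,\dots,c_4,C$, inputs $r,\gamma,\lambda,\epsilon,\delta$ and access to independent samples from $P(\cdot|s_k,a_k)$, $k\in[K]$: put $R'=\lceil c_1\log\frac1{\epsilon(1-\gamma)}\rceil$, $R=\lceil c_2R'/(1-\gamma)\rceil$, $\ell=\log(R'RK/\delta)$, $m=\lceil C\epsilon^{-2}(1-\gamma)^{-3}\ell^{4/3}\rceil$, $m_1=\lceil C(1-\gamma)^{-2}\ell\rceil$ and $\theta^{(0,0)}=\{0\}$. For $i=0,1,\dots,R'$: 1. For every $k$ draw $m$ fresh samples $x$ from $P(\cdot|s_k,a_k)$; let $w^{(i,0)}(k)$ and $z^{(i,0)}(k)$ be the empirical means of $V_{\theta^{(i,0)}}(x)$ and $V_{\theta^{(i,0)}}(x)^2$, let $\sigma^{(i,0)}(k)=z^{(i,0)}(k)-w^{(i,0)}(k)^2$ and $\epsilon^{(i,0)}(k)=c_3\big[\sqrt{\ell\,\sigma^{(i,0)}(k)/m}+\ell(1-\gamma)^{-1}m^{-3/4}\big]$.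 2. For $j=1,\dots,R$: for every $k$ draw $m_1$ fresh samples $x$ from $P(\cdot|s_k,a_k)$; let $w^{(i,j)}(k)$ be $w^{(i,0)}(k)$ plus the empirical mean of $V_{\theta^{(i,j-1)}}(x)-V_{\theta^{(i,0)}}(x)$, let $\epsilon^{(i,j)}(k)=\epsilon^{(i,0)}(k)+c_4(1-\gamma)^{-1}2^{-i}\sqrt{\ell/m_1}$ and $\bar w^{(i,j)}(k)=\max\{0,\min\{w^{(i,j)}(k)-\epsilon^{(i,j)}(k),(1-\gamma)^{-1}\}\}$. Put $\theta^{(i,j)}=\theta^{(i,j-1)}\cup\{\bar w^{(i,j)}\}$. 3. Put $\theta^{(i+1,0)}=\theta^{(i,R)}$. The output is $\theta=\theta^{(R',R)}$. Claim. There are absolute positive constants $c_1,\dots,c_4,C$ and $c_{\rm low},c_{\rm up}$ such that for all $M,\phi,\lambda,\epsilon,\delta$ as above, the total number $N$ of samples taken by the algorithm satisfies $$N\le c_{\rm up}\,\frac{K}{(1-\gamma)^3\epsilon^2}\Big(1+\log\frac{K}{\epsilon\delta(1-\gamma)}\Big)^{4/3}\Big(1+\log\frac1{\epsilon(1-\gamma)}\Big)^2,$$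 $$N\ge c_{\rm low}\,\frac{K}{(1-\gamma)^3\epsilon^2}\Big(1+\log\frac{K}{\delta(1-\gamma)}\Big)^{4/3}\Big(1+\log\frac1{\epsilon(1-\gamma)}\Big),$$ and with probability at least $1-\delta$ every policy $\pi_\theta$ is $\epsilon$-optimal from every initial state. -/

import Mathlib

open MeasureTheory

noncomputable section

namespace OPPQ

/-! ### Discounted Markov decision processes -/

/-- A discounted MDP with state space `S` and action space `A`: transition distributions
`P(· | s, a)`, rewards in `[0, 1]`, and a discount factor in `(0, 1)`. -/
structure MDP (S A : Type*) where
  P : S → A → PMF S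
  r : S → A → ℝ
  r_mem : ∀ s a, r s a ∈ Set.Icc (0 : ℝ) 1
  γ : ℝ
  γ_mem : γ ∈ Set.Ioo (0 : ℝ) 1

namespace MDP

variable {S A : Type*}

/-- The transition probability `P(s' | s, a)` as a real number. -/
def prob (M : MDP S A) (s : S) (a : A) (s' : S) : ℝ := (M.P s a s').toReal

/-- The law of the state `sᵗ` when the chain starts in `s⁰ = s` and the policy `π` is played. -/
def stateLaw (M : MDP S A) (π : S → A) (s : S) : ℕ → PMF S
  | 0 => PMF.pure s
  | t + 1 => (stateLaw M π s t).bind fun x => M.P x (π x)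

/-- The value function `v^π(s) = ∑ₜ γᵗ 𝔼[r(sᵗ, π(sᵗ)) | s⁰ = s]`. -/
def value [Fintype S] (M : MDP S A) (π : S → A) (s : S) : ℝ :=
  ∑' t : ℕ, M.γ ^ t * ∑ x : S, (M.stateLaw π s t x).toReal * M.r x (π x)

/-- The optimal value function `v^*(s) = max_π v^π(s)`; the maximum is over the policies
`S → A`, which are finitely many when `S` and `A` are finite. -/
def optValue [Fintype S] (M : MDP S A) (s : S) : ℝ := ⨆ π : S → A, M.value π s

/-- `π` is `ε`-optimal from every initial state. -/
def IsEpsOptimal [Fintype S] (M : MDP S A) (ε : ℝ) (π : S → A) : Prop :=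
  ∀ s, M.optValue s - ε ≤ M.value π s

/-- `M` admits the linear feature representation `φ : S × A → ℝᵈ`. -/
def AdmitsFeatures (M : MDP S A) {d : ℕ} (φ : S → A → Fin d → ℝ) : Prop :=
  ∃ ψ : Fin d → S → ℝ, ∀ s a s', M.prob s a s' = ∑ k, φ s a k * ψ k s'

end MDP

/-- The state-action pairs `anchor k` are anchors for the features `φ`, and `lam s a` are
coefficients of a convex combination of the anchor features equal to `φ(s, a)`. -/
def IsAnchorCombination {S A : Type*} {d K : ℕ} (φ : S → A → Fin d → ℝ)
    (anchor : Fin K → S × A) (lam : S → A → Fin K → ℝ) : Prop :=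
  ∀ s a, (φ s a = ∑ k, lam s a k • φ (anchor k).1 (anchor k).2) ∧
    ∑ k, lam s a k = 1 ∧ ∀ k, 0 ≤ lam s a k

/-! ### Parametrised values and policies

The features enter in anchor coordinates `lam` (the normalisation in which the anchors have unit
feature vectors).  A parameter `θ` is a finite nonempty set of vectors in `ℝᴷ`. -/

section Param

variable {S A : Type*} {K : ℕ}

/-- `Q_w(s, a) = r(s, a) + γ λ(s, a)ᵀ w`. -/
def paramQ (r : S → A → ℝ) (γ : ℝ) (lam : S → A → Fin K → ℝ) (w : Fin K → ℝ) (s : S) (a : A) : ℝ :=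
  r s a + γ * ∑ k, lam s a k * w k

/-- `V_θ(s) = max_{w ∈ θ} max_a Q_w(s, a)`. -/
def paramV (r : S → A → ℝ) (γ : ℝ) (lam : S → A → Fin K → ℝ) (θ : Finset (Fin K → ℝ)) (s : S) : ℝ :=
  ⨆ w : θ, ⨆ a : A, paramQ r γ lam w s a

/-- `π` is a policy `π_θ`, i.e. `π(s) ∈ argmax_a max_{w ∈ θ} Q_w(s, a)` (ties broken in any way). -/
def IsParamPolicy (r : S → A → ℝ) (γ : ℝ) (lam : S → A → Fin K → ℝ) (θ : Finset (Fin K → ℝ))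
    (π : S → A) : Prop :=
  ∀ s a, (⨆ w : θ, paramQ r γ lam w s a) ≤ ⨆ w : θ, paramQ r γ lam w s (π s)

end Param

/-! ### The algorithm OPPQ-Learning -/

/-- The absolute constants which the algorithm's `Θ(·)` and `C` stand for: in the number of outer
iterations, the number of inner iterations, the two mini-batch sizes, and the two
confidence bounds. -/
structure Constants where
  cOuter : ℝ
  cInner : ℝ
  cBatch : ℝ
  cRef : ℝ
  cOff : ℝ

/-- All constants are positive. -/
structure Constants.Pos (c : Constants) : Prop where
  cOuter : 0 < c.cOuter
  cInner : 0 < c.cInner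
  cBatch : 0 < c.cBatch
  cRef : 0 < c.cRef
  cOff : 0 < c.cOff

/-- `R' = Θ(log(ε⁻¹ (1-γ)⁻¹))`; the outer loop runs over `i = 0, …, R'`. -/
def numOuter (c : Constants) (γ ε : ℝ) : ℕ := ⌈c.cOuter * Real.log (1 / (ε * (1 - γ)))⌉₊

/-- `R = Θ(R' (1-γ)⁻¹)`; the inner loop runs over `j = 1, …, R`. -/
def numInner (c : Constants) (γ ε : ℝ) : ℕ := ⌈c.cInner * (numOuter c γ ε / (1 - γ))⌉₊

/-- `log(R' R K δ⁻¹)`. -/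
def logTerm (c : Constants) (K : ℕ) (γ ε δ : ℝ) : ℝ :=
  Real.log (numOuter c γ ε * numInner c γ ε * K / δ)

/-- The mini-batch size `m = C ε⁻² log(R' R K δ⁻¹)^{4/3} (1-γ)⁻³` of the outer loop. -/
def outerBatch (c : Constants) (K : ℕ) (γ ε δ : ℝ) : ℕ :=
  ⌈c.cBatch * (1 / ε ^ 2) * (logTerm c K γ ε δ ^ (4 / 3 : ℝ) / (1 - γ) ^ 3)⌉₊

/-- The mini-batch size `m₁ = C log(R' R K δ⁻¹) (1-γ)⁻²` of the inner loop. -/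
def innerBatch (c : Constants) (K : ℕ) (γ ε δ : ℝ) : ℕ :=
  ⌈c.cBatch * (logTerm c K γ ε δ / (1 - γ) ^ 2)⌉₊

/-- The generative-model queries: `(i, k, inl ℓ)` is the `ℓ`-th query at the `k`-th anchor at the
start of outer iteration `i`, and `(i, k, inr (j, ℓ))` is the `ℓ`-th query at the `k`-th anchor in
the inner iteration number `j + 1` of the outer iteration `i`. -/
abbrev Query (c : Constants) (K : ℕ) (γ ε δ : ℝ) : Type :=
  Fin (numOuter c γ ε + 1) × Fin K ×
    (Fin (outerBatch c K γ ε δ) ⊕ Fin (numInner c γ ε) × Fin (innerBatch c K γ ε δ))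

/-- The total number of samples which the algorithm takes. -/
def numSamples (c : Constants) (K : ℕ) (γ ε δ : ℝ) : ℕ := Fintype.card (Query c K γ ε δ)

/-- The empirical mean of `f` over a batch of `n` samples. -/
def empMean {S : Type*} {n : ℕ} (f : S → ℝ) (x : Fin n → S) : ℝ := (∑ l, f (x l)) / n

section Algorithm

variable {S A : Type*} {K : ℕ} (c : Constants) (r : S → A → ℝ) (γ : ℝ)
  (lam : S → A → Fin K → ℝ) (ε δ : ℝ)

/-- `w^{(i,0)}(k)`, from `θ = θ^{(i,0)}` and the batch `x` drawn at the `k`-th anchor. -/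
def refMean {n : ℕ} (θ : Finset (Fin K → ℝ)) (x : Fin n → S) : ℝ :=
  empMean (paramV r γ lam θ) x

/-- The empirical variance `σ^{(i,0)}(k) = z^{(i,0)}(k) - w^{(i,0)}(k)²`. -/
def refVar {n : ℕ} (θ : Finset (Fin K → ℝ)) (x : Fin n → S) : ℝ :=
  empMean (fun s => paramV r γ lam θ s ^ 2) x - refMean r γ lam θ x ^ 2

/-- The confidence bound `ε^{(i,0)}(k)`. -/
def refErr (θ : Finset (Fin K → ℝ)) (x : Fin (outerBatch c K γ ε δ) → S) : ℝ :=
  c.cRef * (Real.sqrt (logTerm c K γ ε δ * refVar r γ lam θ x / outerBatch c K γ ε δ) +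
    logTerm c K γ ε δ * (1 - γ)⁻¹ / (outerBatch c K γ ε δ : ℝ) ^ (3 / 4 : ℝ))

/-- The shifted and clipped parameter `w̄^{(i,j)}`, `j ≥ 1`, computed from `θ₀ = θ^{(i,0)}`,
`θ = θ^{(i,j-1)}`, the batches `x₀` drawn at the start of outer iteration `i` and the batches `x`
drawn in the inner iteration `j`. -/
def newParam (i : ℕ) (θ₀ : Finset (Fin K → ℝ)) (x₀ : Fin K → Fin (outerBatch c K γ ε δ) → S)
    (θ : Finset (Fin K → ℝ)) (x : Fin K → Fin (innerBatch c K γ ε δ) → S) : Fin K → ℝ := fun k =>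
  let w : ℝ := empMean (fun s => paramV r γ lam θ s - paramV r γ lam θ₀ s) (x k) +
    refMean r γ lam θ₀ (x₀ k)
  let e : ℝ := refErr c r γ lam ε δ θ₀ (x₀ k) +
    c.cOff * (1 - γ)⁻¹ * (1 / 2) ^ i * Real.sqrt (logTerm c K γ ε δ / innerBatch c K γ ε δ)
  max 0 (min (w - e) (1 - γ)⁻¹)

/-- `θ^{(i,j)}` as a function of `θ₀ = θ^{(i,0)}`:
`θ^{(i,j)} = θ^{(i,j-1)} ∪ {w̄^{(i,j)}}` for `1 ≤ j ≤ R`. -/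
def innerLoop (samples : Query c K γ ε δ → S) (i : Fin (numOuter c γ ε + 1))
    (θ₀ : Finset (Fin K → ℝ)) : (j : ℕ) → j ≤ numInner c γ ε → Finset (Fin K → ℝ)
  | 0, _ => θ₀
  | j + 1, h =>
    let θ := innerLoop samples i θ₀ j (Nat.le_of_succ_le h)
    insert (newParam c r γ lam ε δ i θ₀ (fun k l => samples (i, k, Sum.inl l)) θ
      (fun k l => samples (i, k, Sum.inr (⟨j, h⟩, l)))) θ

/-- `θ^{(i,0)}`: `θ^{(0,0)} = {0}` and `θ^{(i+1,0)} = θ^{(i,R)}`. -/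
def outerLoop (samples : Query c K γ ε δ → S) :
    (i : ℕ) → i ≤ numOuter c γ ε + 1 → Finset (Fin K → ℝ)
  | 0, _ => {0}
  | i + 1, h =>
    innerLoop c r γ lam ε δ samples ⟨i, h⟩ (outerLoop samples i (Nat.le_of_succ_le h))
      (numInner c γ ε) le_rfl

/-- The output `θ^{(R',R)}` of OPPQ-Learning on the given answers of the generative model. -/
def output (samples : Query c K γ ε δ → S) : Finset (Fin K → ℝ) :=
  outerLoop c r γ lam ε δ samples (numOuter c γ ε + 1) le_rfl

end Algorithm

/-- The joint law of the answers of the generative model: independent samples, those at the `k`-th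
anchor `(s_k, a_k)` being distributed as `P(· | s_k, a_k)`. -/
def sampleLaw {S A : Type*} [MeasurableSpace S] {K : ℕ} (c : Constants) (M : MDP S A)
    (anchor : Fin K → S × A) (ε δ : ℝ) : Measure (Query c K M.γ ε δ → S) :=
  Measure.pi fun q => (M.P (anchor q.2.1).1 (anchor q.2.1).2).toMeasure

end OPPQ

end

/-! Write H = 1/(1-γ), B = 2^{-i} H, and E_k for the mean under the k-th anchor law. The algorithm
is value iteration from below at the anchors. Its invariant is `Underestimates`: w(k) ≤ E_k V_θ for
all w in θ. Each P(·|s,a) is a convex combination of the anchor laws, so the invariant makes V_θ a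
subsolution of the evaluation equation of π_θ, whence V_θ ≤ v^{π_θ} ≤ v*
(`Underestimates.paramV_le_value`). Only an upper bound on v* - V_θ is then needed.

Outer iteration i reduces that bound from B to B/2 (`AccurateSamples.innerLoop_halves`). This is
variance reduction: V_θ - V_{θ₀} takes values in [0, B], so batches of order H²ℓ estimate its means
up to a small multiple of B/H, which stays a small multiple of B after accumulating over a horizon
H. The means of V_{θ₀} are estimated once, by a large batch, with an error governed by the standard
deviation. The R inner steps contract the initial error by γ^R ≤ 1/4.

The power H³ instead of H⁴ comes from the total variance: one-step standard deviations of v* add up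
along an optimal trajectory to order H^{3/2}, not H². This is proved with an explicit supersolution
(`MDP.le_varianceBound`). The inequality of arithmetic and geometric means replaces standard
deviations by variances, which pass from the anchors to (s,a) by `anchor_variance_le`.

All of this is deterministic on the event `AccurateSamples`. The averaged functions depend on
earlier samples, but each batch is fresh: `measure_pi_batch_le` freezes all other coordinates,
Bernstein's inequality applies to a fixed function, and a union bound over the batches costs at most
δ. -/

noncomputable section

namespace OPPQ

/-! ### Expectation and variance under a probability mass function -/

section Expect

variable {S : Type*} [Fintype S]

/-- The expectation of `f` under `p`. -/
def expect (p : PMF S) (f : S → ℝ) : ℝ := ∑ x, (p x).toReal * f x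

/-- The variance of `f` under `p`. -/
def variance (p : PMF S) (f : S → ℝ) : ℝ := expect p (fun x => f x ^ 2) - expect p f ^ 2

lemma sum_toReal (p : PMF S) : ∑ x, (p x).toReal = 1 := by
  rw [← ENNReal.toReal_sum fun x _ => p.apply_ne_top x, ← tsum_fintype (L := .unconditional S),
    p.tsum_coe, ENNReal.toReal_one]

lemma expect_const (p : PMF S) (a : ℝ) : expect p (fun _ => a) = a := by
  rw [expect, ← Finset.sum_mul, sum_toReal, one_mul]

lemma expect_mono (p : PMF S) {f g : S → ℝ} (h : ∀ x, f x ≤ g x) : expect p f ≤ expect p g :=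
  Finset.sum_le_sum fun x _ => mul_le_mul_of_nonneg_left (h x) ENNReal.toReal_nonneg

lemma expect_add (p : PMF S) (f g : S → ℝ) :
    expect p (fun x => f x + g x) = expect p f + expect p g := by
  simp only [expect, mul_add, Finset.sum_add_distrib]

lemma expect_sub (p : PMF S) (f g : S → ℝ) :
    expect p (fun x => f x - g x) = expect p f - expect p g := by
  simp only [expect, mul_sub, Finset.sum_sub_distrib]

lemma expect_mul_left (p : PMF S) (a : ℝ) (f : S → ℝ) :
    expect p (fun x => a * f x) = a * expect p f := by
  simp only [expect, Finset.mul_sum, mul_left_comm]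

lemma expect_neg (p : PMF S) (f : S → ℝ) : expect p (fun x => -f x) = -expect p f := by
  simp only [expect, mul_neg, Finset.sum_neg_distrib]

lemma expect_nonneg (p : PMF S) {f : S → ℝ} (h : ∀ x, 0 ≤ f x) : 0 ≤ expect p f :=
  Finset.sum_nonneg fun x _ => mul_nonneg ENNReal.toReal_nonneg (h x)

lemma expect_le (p : PMF S) {f : S → ℝ} {b : ℝ} (h : ∀ x, f x ≤ b) : expect p f ≤ b :=
  (expect_mono p h).trans_eq (expect_const p b)

lemma variance_eq (p : PMF S) (f : S → ℝ) :
    variance p f = expect p fun x => (f x - expect p f) ^ 2 := by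
  have h : (fun x => (f x - expect p f) ^ 2)
      = fun x => f x ^ 2 - (2 * expect p f) * f x + expect p f ^ 2 := by
    funext x; ring
  rw [h, expect_add p (fun x => f x ^ 2 - (2 * expect p f) * f x), expect_sub, expect_mul_left,
    expect_const, variance]
  ring

lemma variance_nonneg (p : PMF S) (f : S → ℝ) : 0 ≤ variance p f := by
  rw [variance_eq]
  exact expect_nonneg p fun x => sq_nonneg _

lemma variance_neg (p : PMF S) (f : S → ℝ) : variance p (fun x => -f x) = variance p f := by
  simp only [variance, expect_neg, neg_sq]

lemma variance_le_sq (p : PMF S) {f : S → ℝ} {b : ℝ} (h : ∀ x, f x ∈ Set.Icc 0 b) :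
    variance p f ≤ b ^ 2 := by
  have h1 : expect p (fun x => f x ^ 2) ≤ b ^ 2 :=
    expect_le p fun x => pow_le_pow_left₀ (h x).1 (h x).2 2
  have := sq_nonneg (expect p f)
  unfold variance
  linarith

lemma variance_add_le (p : PMF S) (f g : S → ℝ) :
    variance p (fun x => f x + g x) ≤ 2 * variance p f + 2 * variance p g := by
  rw [variance_eq, variance_eq p f, variance_eq p g, ← expect_mul_left, ← expect_mul_left,
    ← expect_add, expect_add p f g]
  refine expect_mono p fun x => ?_
  nlinarith [sq_nonneg ((f x - expect p f) - (g x - expect p g))]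

end Expect

/-! ### A Bernstein inequality for empirical means -/

section Bernstein

variable {S : Type*} [Fintype S]

/-- The Chernoff exponent -tna + nt²v is optimised under the constraint tb ≤ 1. For small variance
the constraint binds and t = 1/b is taken; otherwise t = √(L/(nv)) is admissible. -/
lemma exists_chernoff_rate {v b L n : ℝ} (hv : 0 ≤ v) (hb : 0 < b) (hL : 0 ≤ L) (hn : 0 < n) :
    ∃ t, 0 ≤ t ∧ t * b ≤ 1 ∧
      -t * (n * (2 * Real.sqrt (v * L / n) + 2 * b * L / n)) + n * (t ^ 2 * v) ≤ -L := by
  have hn' := hn.ne'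
  rcases le_or_gt (n * v) (L * b ^ 2) with h | h
  · refine ⟨1 / b, by positivity, by field_simp; exact le_rfl, ?_⟩
    have h1 : n * ((1 / b) ^ 2 * v) ≤ L := by
      rw [one_div, inv_pow, mul_left_comm, inv_mul_le_iff₀ (by positivity)]
      linarith
    have h2 : -(1 / b) * (n * (2 * Real.sqrt (v * L / n) + 2 * b * L / n))
        = -(2 * n / b * Real.sqrt (v * L / n)) - 2 * L := by
      field_simp
      ring
    have h3 : 0 ≤ 2 * n / b * Real.sqrt (v * L / n) := by positivity
    rw [h2]
    linarith
  · have hv' : 0 < v := by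
      by_contra hv0
      have : v = 0 := le_antisymm (not_lt.mp hv0) hv
      rw [this, mul_zero] at h
      nlinarith [mul_nonneg hL (sq_nonneg b)]
    refine ⟨Real.sqrt (L / (n * v)), Real.sqrt_nonneg _, ?_, ?_⟩
    · rw [← Real.sqrt_sq hb.le, ← Real.sqrt_mul (by positivity)]
      refine Real.sqrt_le_one.mpr ?_
      rw [div_mul_eq_mul_div, div_le_one (by positivity)]
      exact h.le
    · have h1 : Real.sqrt (L / (n * v)) * Real.sqrt (v * L / n) = L / n := by
        rw [← Real.sqrt_mul (by positivity)]
        have : L / (n * v) * (v * L / n) = (L / n) ^ 2 := by field_simp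
        rw [this, Real.sqrt_sq (by positivity)]
      have h2 : Real.sqrt (L / (n * v)) ^ 2 = L / (n * v) := Real.sq_sqrt (by positivity)
      have h3 : 0 ≤ Real.sqrt (L / (n * v)) * (2 * b * L) := by positivity
      rw [h2]
      have h4 : n * (L / (n * v) * v) = L := by field_simp
      rw [h4]
      have h5 : -Real.sqrt (L / (n * v)) * (n * (2 * Real.sqrt (v * L / n) + 2 * b * L / n))
          = -(2 * n * (Real.sqrt (L / (n * v)) * Real.sqrt (v * L / n)))
            - Real.sqrt (L / (n * v)) * (2 * b * L) := by
        field_simp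
        ring
      have h6 : 2 * n * (L / n) = 2 * L := by field_simp
      rw [h5, h1, h6]
      linarith

/-- From e^y ≤ 1 + y + y² for |y| ≤ 1; the linear term has mean zero. -/
lemma expect_exp_le (p : PMF S) {f : S → ℝ} {b t : ℝ} (hf : ∀ x, |f x - expect p f| ≤ b)
    (ht : 0 ≤ t) (htb : t * b ≤ 1) :
    expect p (fun x => Real.exp (t * (f x - expect p f))) ≤ Real.exp (t ^ 2 * variance p f) := by
  calc expect p (fun x => Real.exp (t * (f x - expect p f)))
      ≤ expect p (fun x => 1 + t * (f x - expect p f) + t ^ 2 * (f x - expect p f) ^ 2) := by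
        refine expect_mono p fun x => ?_
        have h1 : |t * (f x - expect p f)| ≤ 1 := by
          rw [abs_mul, abs_of_nonneg ht]
          exact (mul_le_mul_of_nonneg_left (hf x) ht).trans htb
        have h2 := (abs_le.mp (Real.abs_exp_sub_one_sub_id_le h1)).2
        rw [mul_pow] at h2
        linarith
    _ = 1 + t ^ 2 * variance p f := by
        rw [expect_add, expect_add, expect_const, expect_mul_left, expect_mul_left, expect_sub,
          expect_const, variance_eq]
        ring
    _ ≤ Real.exp (t ^ 2 * variance p f) := by
        linarith [Real.add_one_le_exp (t ^ 2 * variance p f)]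


lemma abs_sub_expect_le (p : PMF S) {f : S → ℝ} {b : ℝ} (hf : ∀ x, f x ∈ Set.Icc 0 b) (x : S) :
    |f x - expect p f| ≤ b := by
  have h1 := expect_nonneg p fun x => (hf x).1
  have h2 := expect_le p fun x => (hf x).2
  rw [abs_le]
  constructor <;> linarith [(hf x).1, (hf x).2]

variable [MeasurableSpace S] [MeasurableSingletonClass S]

lemma bernstein_upper (p : PMF S) {f : S → ℝ} {b L : ℝ} {n : ℕ} (hn : 0 < n) (hb : 0 < b)
    (hL : 0 ≤ L) (hf : ∀ x, |f x - expect p f| ≤ b) :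
    (Measure.pi fun _ : Fin n => p.toMeasure).real
      {x | 2 * Real.sqrt (variance p f * L / n) + 2 * b * L / n ≤ empMean f x - expect p f}
      ≤ Real.exp (-L) := by
  have hn' : (0 : ℝ) < n := Nat.cast_pos.mpr hn
  obtain ⟨t, ht, htb, hle⟩ := exists_chernoff_rate (variance_nonneg p f) hb hL hn'
  set a := 2 * Real.sqrt (variance p f * L / n) + 2 * b * L / n with ha
  set μ := Measure.pi fun _ : Fin n => p.toMeasure
  have h1 := ProbabilityTheory.measure_ge_le_exp_mul_mgf (μ := μ)
    (X := fun x => ∑ l, (f (x l) - expect p f)) (n * a) ht .of_finite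
  have h2 : {x : Fin n → S | a ≤ empMean f x - expect p f}
      = {x | n * a ≤ ∑ l, (f (x l) - expect p f)} := by
    ext x
    simp only [Set.mem_ofPred_eq, empMean, Finset.sum_sub_distrib, Finset.sum_const,
      Finset.card_univ, Fintype.card_fin, nsmul_eq_mul]
    rw [div_sub' hn'.ne', le_div_iff₀ hn', mul_comm]
  have h3 : ProbabilityTheory.mgf (fun x : Fin n → S => ∑ l, (f (x l) - expect p f)) μ t
      = expect p (fun x => Real.exp (t * (f x - expect p f))) ^ n := by
    simp only [ProbabilityTheory.mgf, Finset.mul_sum, Real.exp_sum]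
    rw [integral_fintype_prod_eq_pow (fun x => Real.exp (t * (f x - expect p f))),
      PMF.integral_eq_sum, Fintype.card_fin]
    rfl
  rw [h2]
  refine h1.trans ?_
  rw [h3]
  calc _ ≤ Real.exp (-t * (n * a)) * Real.exp (t ^ 2 * variance p f) ^ n := by
        refine mul_le_mul_of_nonneg_left (pow_le_pow_left₀ ?_ (expect_exp_le p hf ht htb) n)
          (Real.exp_pos _).le
        exact expect_nonneg p fun x => (Real.exp_pos _).le
    _ = Real.exp (-t * (n * a) + n * (t ^ 2 * variance p f)) := by
        rw [← Real.exp_nat_mul, ← Real.exp_add]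
    _ ≤ _ := Real.exp_le_exp.mpr hle

/-- **Bernstein's inequality** for the empirical mean of `n` independent samples. -/
lemma bernstein (p : PMF S) {f : S → ℝ} {b L : ℝ} {n : ℕ} (hn : 0 < n) (hb : 0 < b)
    (hL : 0 ≤ L) (hf : ∀ x, |f x - expect p f| ≤ b) :
    (Measure.pi fun _ : Fin n => p.toMeasure).real
      {x | 2 * Real.sqrt (variance p f * L / n) + 2 * b * L / n < |empMean f x - expect p f|}
      ≤ 2 * Real.exp (-L) := by
  have h1 := bernstein_upper p hn hb hL hf
  have h2 := bernstein_upper p (f := fun x => -f x) hn hb hL (fun x => by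
    rw [expect_neg, neg_sub_neg, abs_sub_comm]; exact hf x)
  rw [variance_neg, expect_neg] at h2
  refine (measureReal_mono (s₂ := _ ∪ _) ?_ (measure_ne_top _ _)).trans
    ((measureReal_union_le _ _).trans ((add_le_add h1 h2).trans_eq (by ring)))
  intro x hx
  rw [Set.mem_ofPred_eq] at hx
  rcases lt_abs.mp hx with h | h
  · left
    rw [Set.mem_ofPred_eq]
    exact h.le
  · right
    have : empMean (fun s => -f s) x = -empMean f x := by
      simp only [empMean, Finset.sum_neg_distrib, neg_div]
    simp only [Set.mem_ofPred_eq, this]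
    linarith

/-- The Hoeffding-type consequence of Bernstein's inequality when `L ≤ n`. -/
lemma bernstein_range (p : PMF S) {f : S → ℝ} {b L : ℝ} {n : ℕ} (hn : 0 < n) (hb : 0 < b)
    (hL : 0 ≤ L) (hLn : L ≤ n) (hf : ∀ x, f x ∈ Set.Icc 0 b) :
    (Measure.pi fun _ : Fin n => p.toMeasure).real
      {x | 4 * b * Real.sqrt (L / n) < |empMean f x - expect p f|} ≤ 2 * Real.exp (-L) := by
  have hn' : (0 : ℝ) < n := Nat.cast_pos.mpr hn
  refine (measureReal_mono ?_ (measure_ne_top _ _)).trans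
    (bernstein p hn hb hL (abs_sub_expect_le p hf))
  intro x hx
  rw [Set.mem_ofPred_eq] at hx ⊢
  refine lt_of_le_of_lt ?_ hx
  have h1 : Real.sqrt (variance p f * L / n) ≤ b * Real.sqrt (L / n) := by
    rw [mul_div_assoc, Real.sqrt_mul (variance_nonneg p f)]
    refine mul_le_mul_of_nonneg_right ?_ (Real.sqrt_nonneg _)
    exact Real.sqrt_le_iff.mpr ⟨hb.le, variance_le_sq p hf⟩
  have h2 : L / n ≤ Real.sqrt (L / n) :=
    Real.le_sqrt_of_sq_le (by
      have h0 : 0 ≤ L / n := by positivity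
      have h1 : L / n ≤ 1 := (div_le_one hn').mpr hLn
      nlinarith)
  have h3 : 2 * b * L / n ≤ 2 * b * Real.sqrt (L / n) := by
    rw [mul_div_assoc]
    exact mul_le_mul_of_nonneg_left h2 (by positivity)
  linarith

end Bernstein

/-! ### Adaptive test functions on a fresh batch of samples -/

/-- If, for every fixed value of `b`, the batch of samples `x ∘ e` lies in `bad b` with
probability at most `c`, then so it does for `b = F x` that does not depend on the batch. -/
lemma measure_pi_batch_le {ι S β : Type*} [Fintype ι] [Finite S] [MeasurableSpace S]
    [MeasurableSingletonClass S] {n : ℕ} (μ : ι → Measure S) [∀ i, IsProbabilityMeasure (μ i)]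
    {e : Fin n → ι} (he : Function.Injective e) (F : (ι → S) → β)
    (hF : ∀ x y, (∀ q, q ∉ Set.range e → x q = y q) → F x = F y) (bad : β → Set (Fin n → S))
    {c : ℝ} (h : ∀ b, (Measure.pi fun l => μ (e l)).real (bad b) ≤ c) :
    (Measure.pi μ).real {x | (fun l => x (e l)) ∈ bad (F x)} ≤ c := by
  classical
  have hall : ∀ b, (Measure.pi fun l => μ (e l)) (bad b) ≤ ENNReal.ofReal c := fun b => by
    rw [← ENNReal.ofReal_toReal (measure_ne_top (Measure.pi fun l => μ (e l)) (bad b))]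
    exact ENNReal.ofReal_le_ofReal (h b)
  rcases isEmpty_or_nonempty (ι → S) with hE | ⟨⟨x₀⟩⟩
  · have : {x : ι → S | (fun l => x (e l)) ∈ bad (F x)} = ∅ := Set.eq_empty_of_isEmpty _
    -- An empty sample space would have total mass 0, against the probability hypothesis; only 0 ≤ c
    -- is at stake here.
    rw [this, measureReal_empty]
    by_contra hc
    have h0 : (0 : ENNReal) < Measure.pi μ Set.univ := by simp
    rw [Set.eq_empty_of_isEmpty (Set.univ : Set (ι → S)), measure_empty] at h0
    exact lt_irrefl _ h0
  obtain ⟨p, hp⟩ : ∃ p : ι → Prop, ∀ q, p q ↔ q ∈ Set.range e := ⟨_, fun _ => Iff.rfl⟩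
  set Φ := MeasurableEquiv.piEquivPiSubtypeProd (fun _ : ι => S) p with hΦ
  have hmp := measurePreserving_piEquivPiSubtypeProd μ p
  set E : Set (ι → S) := {x | (fun l => x (e l)) ∈ bad (F x)} with hEdef
  let g : Fin n ≃ Subtype p := (Equiv.ofInjective e he).trans (Equiv.subtypeEquivRight fun q => (hp q).symm)
  have hg := measurePreserving_piCongrLeft (fun q : Subtype p => μ q) g
  have hc : (Measure.pi μ) E ≤ ENNReal.ofReal c := by
    have h1 := hmp.measure_preimage_equiv (Φ.symm ⁻¹' E)
    have h2 : Φ ⁻¹' (Φ.symm ⁻¹' E) = E := by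
      rw [← Set.preimage_comp, Φ.symm_comp_self, Set.preimage_id]
    rw [h2] at h1
    -- Fubini with the coordinates outside the batch as the outer variable `z`; finiteness makes
    -- every set measurable.
    rw [h1, Measure.prod_apply_symm (Set.toFinite _).measurableSet]
    refine (lintegral_mono (g := fun _ => ENNReal.ofReal c) fun z => ?_).trans (by simp)
    rw [← hg.measure_preimage_equiv]
    rcases isEmpty_or_nonempty (Fin n → S) with hE2 | ⟨⟨y₀⟩⟩
    · rw [Set.eq_empty_of_isEmpty (_ ⁻¹' _)]
      simp
    -- For fixed `z` the value of `F` is constant in the batch, so it can be read off at an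
    -- arbitrary filling `y₀`.
    refine le_trans (measure_mono ?_)
      (hall (F (Φ.symm (MeasurableEquiv.piCongrLeft (fun _ => S) g y₀, z))))
    intro y hy
    simp only [Set.mem_preimage, hEdef, Set.mem_ofPred_eq] at hy
    have e1 : (fun l => Φ.symm (MeasurableEquiv.piCongrLeft (fun _ => S) g y, z) (e l)) = y := by
      funext l
      have : p (e l) := (hp _).mpr ⟨l, rfl⟩
      simp only [hΦ, MeasurableEquiv.piEquivPiSubtypeProd, MeasurableEquiv.symm_mk,
        MeasurableEquiv.coe_mk, Equiv.piEquivPiSubtypeProd_symm_apply, this, dif_pos]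
      exact Equiv.piCongrLeft_apply_apply (fun _ => S) g y l
    rw [e1] at hy
    convert hy using 2
    refine hF _ _ fun q hq => ?_
    simp only [hΦ, MeasurableEquiv.piEquivPiSubtypeProd, MeasurableEquiv.symm_mk,
        MeasurableEquiv.coe_mk, Equiv.piEquivPiSubtypeProd_symm_apply]
    rw [dif_neg (mt (hp q).mp hq), dif_neg (mt (hp q).mp hq)]
  rcases le_or_gt 0 c with h0 | h0
  · exact ENNReal.toReal_le_of_le_ofReal h0 hc
  · exact absurd ((measureReal_nonneg).trans (h (F x₀))) (not_le.mpr h0)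

/-! ### Expectations under point masses and mixtures. -/

section Expect

variable {S : Type*} [Fintype S]

lemma expect_pure (a : S) (f : S → ℝ) : expect (PMF.pure a) f = f a := by
  classical
  rw [expect, Finset.sum_eq_single a]
  · simp
  · intro b _ hb
    simp [hb]
  · simp

lemma expect_bind (p : PMF S) (q : S → PMF S) (f : S → ℝ) :
    expect (p.bind q) f = expect p fun y => expect (q y) f := by
  have h : ∀ x, ((p.bind q) x).toReal = ∑ y, (p y).toReal * (q y x).toReal := fun x => by
    rw [PMF.bind_apply, tsum_fintype, ENNReal.toReal_sum fun y _ =>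
      ENNReal.mul_ne_top (p.apply_ne_top y) ((q y).apply_ne_top x)]
    simp only [ENNReal.toReal_mul]
  simp only [expect, h, Finset.sum_mul, Finset.mul_sum]
  rw [Finset.sum_comm]
  simp only [mul_assoc]

end Expect

namespace MDP

/-! ### Policy evaluation -/

section Eval

variable {S A : Type*} (M : MDP S A)

lemma γ_pos : 0 < M.γ := M.γ_mem.1

lemma one_sub_γ_pos : 0 < 1 - M.γ := sub_pos.mpr M.γ_mem.2

/-- `stateLaw` appends the last transition, whereas the Bellman equation splits off the first one.
-/
lemma stateLaw_succ_eq (π : S → A) (s : S) (t : ℕ) :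
    M.stateLaw π s (t + 1) = (M.P s (π s)).bind fun x => M.stateLaw π x t := by
  induction t generalizing s with
  | zero => simp [stateLaw]
  | succ t ih =>
    rw [stateLaw, ih, PMF.bind_bind]
    rfl

variable [Fintype S]

/-- The expected reward at time `t`. -/
def rewardAt (π : S → A) (s : S) (t : ℕ) : ℝ :=
  expect (M.stateLaw π s t) fun x => M.r x (π x)

lemma rewardAt_zero (π : S → A) (s : S) : M.rewardAt π s 0 = M.r s (π s) :=
  expect_pure s _

lemma rewardAt_succ (π : S → A) (s : S) (t : ℕ) :
    M.rewardAt π s (t + 1) = expect (M.P s (π s)) fun x => M.rewardAt π x t := by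
  rw [rewardAt, stateLaw_succ_eq, expect_bind]
  rfl

lemma rewardAt_mem (π : S → A) (s : S) (t : ℕ) : M.rewardAt π s t ∈ Set.Icc (0 : ℝ) 1 :=
  ⟨expect_nonneg _ fun x => (M.r_mem x (π x)).1, expect_le _ fun x => (M.r_mem x (π x)).2⟩

lemma hasSum_value (π : S → A) (s : S) :
    HasSum (fun t => M.γ ^ t * M.rewardAt π s t) (M.value π s) := by
  refine Summable.hasSum ?_
  refine Summable.of_nonneg_of_le
    (fun t => mul_nonneg (pow_nonneg M.γ_pos.le t) (M.rewardAt_mem π s t).1)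
    (fun t => ?_) (summable_geometric_of_lt_one M.γ_pos.le M.γ_mem.2)
  exact mul_le_of_le_one_right (pow_nonneg M.γ_pos.le t) (M.rewardAt_mem π s t).2

/-- The Bellman equation of a policy. -/
lemma value_eq (π : S → A) (s : S) :
    M.value π s = M.r s (π s) + M.γ * expect (M.P s (π s)) (M.value π) := by
  have h1 := M.hasSum_value π s
  have h2 : HasSum (fun t => M.γ ^ (t + 1) * M.rewardAt π s (t + 1))
      (M.γ * expect (M.P s (π s)) (M.value π)) := by
    have h3 := (hasSum_sum (s := Finset.univ) fun x _ =>
      (M.hasSum_value π x).mul_left (M.P s (π s) x).toReal).mul_left M.γ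
    refine (congrArg (fun f => HasSum f _) ?_).mp h3
    funext t
    rw [rewardAt_succ, expect, Finset.mul_sum, Finset.mul_sum]
    exact Finset.sum_congr rfl fun x _ => by ring
  have h4 := (hasSum_nat_add_iff' 1).mpr h1
  have h5 := h4.unique h2
  simp only [Finset.sum_range_one, pow_zero, one_mul, rewardAt_zero] at h5
  linarith

/-- The maximum principle for discounted averages. -/
lemma nonpos_of_le_discount {π : S → A} {u : S → ℝ}
    (h : ∀ s, u s ≤ M.γ * expect (M.P s (π s)) u) (s : S) : u s ≤ 0 := by
  obtain ⟨x, -, hx⟩ := Finset.exists_max_image Finset.univ u ⟨s, Finset.mem_univ s⟩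
  have h1 : expect (M.P x (π x)) u ≤ u x := expect_le _ fun y => hx y (Finset.mem_univ y)
  have h2 := mul_le_mul_of_nonneg_left h1 M.γ_pos.le
  have h3 : u x ≤ 0 := by nlinarith [h x, M.one_sub_γ_pos]
  exact (hx s (Finset.mem_univ s)).trans h3

lemma le_value {π : S → A} {u : S → ℝ}
    (h : ∀ s, u s ≤ M.r s (π s) + M.γ * expect (M.P s (π s)) u) (s : S) :
    u s ≤ M.value π s := by
  have := M.nonpos_of_le_discount (π := π) (u := fun x => u x - M.value π x) (fun x => by
    rw [expect_sub]
    linarith [h x, M.value_eq π x]) s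
  linarith

lemma value_le {π : S → A} {u : S → ℝ}
    (h : ∀ s, M.r s (π s) + M.γ * expect (M.P s (π s)) u ≤ u s) (s : S) :
    M.value π s ≤ u s := by
  have := M.nonpos_of_le_discount (π := π) (u := fun x => M.value π x - u x) (fun x => by
    rw [expect_sub]
    linarith [h x, M.value_eq π x]) s
  linarith

lemma value_mem (π : S → A) (s : S) : M.value π s ∈ Set.Icc 0 (1 - M.γ)⁻¹ := by
  have hγ := M.one_sub_γ_pos
  constructor
  · refine M.le_value (u := fun _ => 0) (fun x => ?_) s
    rw [expect_const]
    linarith [(M.r_mem x (π x)).1]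
  · refine M.value_le (u := fun _ => (1 - M.γ)⁻¹) (fun x => ?_) s
    rw [expect_const]
    have : (1 - M.γ) * (1 - M.γ)⁻¹ = 1 := mul_inv_cancel₀ hγ.ne'
    linarith [(M.r_mem x (π x)).2]

variable [Finite A]

lemma value_le_optValue (π : S → A) (s : S) : M.value π s ≤ M.optValue s :=
  le_ciSup (f := fun π => M.value π s) (Set.toFinite _).bddAbove π

/-- There is a policy that is optimal from every initial state. -/
lemma exists_optimal [Nonempty A] : ∃ π : S → A, ∀ s, M.optValue s = M.value π s := by
  -- A maximiser of the sum of the values cannot be improved strictly at any state. Its greedy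
  -- policy is at least as good everywhere, hence has the same value, which therefore solves the
  -- optimality equation and dominates every policy.
  obtain ⟨π, hπ⟩ := Finite.exists_max fun π : S → A => ∑ s, M.value π s
  have hgreedy : ∀ s, ∃ a, ∀ b, M.r s b + M.γ * expect (M.P s b) (M.value π)
      ≤ M.r s a + M.γ * expect (M.P s a) (M.value π) := fun s =>
    Finite.exists_max fun a => M.r s a + M.γ * expect (M.P s a) (M.value π)
  choose ρ hρ using hgreedy
  have h1 : ∀ s, M.value π s ≤ M.value ρ s :=
    M.le_value fun s => (M.value_eq π s).trans_le (hρ s (π s))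
  have h2 : ∀ s, M.value π s = M.value ρ s := by
    have := (Finset.sum_eq_sum_iff_of_le fun s _ => h1 s).mp
      (le_antisymm (Finset.sum_le_sum fun s _ => h1 s) (hπ ρ))
    exact fun s => this s (Finset.mem_univ s)
  have h3 : M.value ρ = M.value π := funext fun s => (h2 s).symm
  refine ⟨π, fun s => le_antisymm (ciSup_le fun τ => ?_) (M.value_le_optValue π s)⟩
  refine M.value_le (fun x => (hρ x (τ x)).trans_eq ?_) s
  rw [h2 x, M.value_eq ρ x, h3]

end Eval

/-! ### The total variance bound -/

section TotalVariance

variable {S A : Type*} [Fintype S] (M : MDP S A)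

/-- The Bellman equation gives γ E v = v - r, so γ² Var = γ² E v² - (v - r)². Weakening γ² to γ
leaves a discounted difference of v², which telescopes along trajectories, plus at most 2v. -/
lemma sq_γ_mul_variance_le (π : S → A) (s : S) :
    M.γ ^ 2 * variance (M.P s (π s)) (M.value π) ≤
      M.γ * expect (M.P s (π s)) (fun x => M.value π x ^ 2) - M.value π s ^ 2
        + 2 * M.value π s := by
  have hγ := M.γ_pos
  have h1 := M.value_eq π s
  have h2 := M.value_mem π s
  have hr := M.r_mem s (π s)
  have h3 : 0 ≤ expect (M.P s (π s)) (fun x => M.value π x ^ 2) :=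
    expect_nonneg _ fun x => sq_nonneg _
  have h4 : M.γ ^ 2 * variance (M.P s (π s)) (M.value π)
      = M.γ * (M.γ * expect (M.P s (π s)) (fun x => M.value π x ^ 2))
        - (M.value π s - M.r s (π s)) ^ 2 := by
    rw [h1, variance]
    ring
  rw [h4]
  have h5 : M.γ * (M.γ * expect (M.P s (π s)) (fun x => M.value π x ^ 2))
      ≤ M.γ * expect (M.P s (π s)) (fun x => M.value π x ^ 2) :=
    mul_le_of_le_one_left (mul_nonneg hγ.le h3) M.γ_mem.2.le
  nlinarith [h2.1, hr.1, hr.2, mul_nonneg h2.1 (sub_nonneg.mpr hr.2)]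

/-- A supersolution of the evaluation equation with the cost
`α (x + γ² Var(v^π) / x) + 2 β`, which adds up the standard deviations along a trajectory. -/
def varianceBound (π : S → A) (α β x : ℝ) (s : S) : ℝ :=
  α * (x * (1 - M.γ)⁻¹ + (2 * (1 - M.γ)⁻¹ ^ 2 - M.value π s ^ 2) / x) + 2 * β * (1 - M.γ)⁻¹

lemma varianceBound_nonneg (π : S → A) {α β x : ℝ} (hα : 0 ≤ α) (hβ : 0 ≤ β) (hx : 0 < x)
    (s : S) : 0 ≤ M.varianceBound π α β x s := by
  have hγ := M.one_sub_γ_pos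
  have h2 := M.value_mem π s
  have h3 : M.value π s ^ 2 ≤ (1 - M.γ)⁻¹ ^ 2 := pow_le_pow_left₀ h2.1 h2.2 2
  have h4 : 0 ≤ (2 * (1 - M.γ)⁻¹ ^ 2 - M.value π s ^ 2) / x :=
    div_nonneg (by nlinarith [sq_nonneg (1 - M.γ)⁻¹]) hx.le
  unfold varianceBound
  positivity

lemma varianceBound_le (π : S → A) {α β x : ℝ} (hα : 0 ≤ α) (hx : 0 < x) (s : S) :
    M.varianceBound π α β x s ≤
      α * (x * (1 - M.γ)⁻¹ + 2 * (1 - M.γ)⁻¹ ^ 2 / x) + 2 * β * (1 - M.γ)⁻¹ := by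
  unfold varianceBound
  gcongr
  linarith [sq_nonneg (M.value π s)]

/-- The term -v² telescopes the variances by `sq_γ_mul_variance_le`; the constant 2H² releases
(1-γ)·2H² = 2H ≥ 2v per step, which pays for the remainder 2v. Constant costs per step are
multiplied by H. -/
lemma le_varianceBound (π : S → A) {α β x : ℝ} (hα : 0 ≤ α) (hx : 0 < x) (s : S) :
    α * (x + M.γ ^ 2 * variance (M.P s (π s)) (M.value π) / x) + 2 * β
        + M.γ * expect (M.P s (π s)) (M.varianceBound π α β x)
      ≤ M.varianceBound π α β x s := by
  have hγ := M.one_sub_γ_pos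
  set H := (1 - M.γ)⁻¹ with hH
  have hH1 : M.γ * H = H - 1 := by
    have : (1 - M.γ) * H = 1 := mul_inv_cancel₀ hγ.ne'
    linarith
  have h1 : expect (M.P s (π s)) (M.varianceBound π α β x)
      = α * (x * H + (2 * H ^ 2 - expect (M.P s (π s)) (fun y => M.value π y ^ 2)) / x)
        + 2 * β * H := by
    have : M.varianceBound π α β x
        = fun y => (α * (x * H + 2 * H ^ 2 / x) + 2 * β * H) - (α / x) * M.value π y ^ 2 := by
      funext y
      rw [varianceBound, ← hH]
      ring
    rw [this, expect_sub, expect_mul_left, expect_const]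
    ring
  have h2 := M.sq_γ_mul_variance_le π s
  have h3 := M.value_mem π s
  set v := M.value π s
  set W := M.γ ^ 2 * variance (M.P s (π s)) (M.value π)
  set E := expect (M.P s (π s)) (fun y => M.value π y ^ 2)
  have h4 : W + M.γ * (2 * H ^ 2 - E) ≤ 2 * H ^ 2 - v ^ 2 := by
    have : M.γ * (2 * H ^ 2) = 2 * H * (H - 1) := by rw [← hH1]; ring
    nlinarith [h3.2]
  have h5 : W / x + M.γ * ((2 * H ^ 2 - E) / x) ≤ (2 * H ^ 2 - v ^ 2) / x := by
    rw [← mul_div_assoc, ← add_div]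
    exact div_le_div_of_nonneg_right h4 hx.le
  have h6 := mul_le_mul_of_nonneg_left h5 hα
  rw [h1, varianceBound]
  have h7 : M.γ * (α * (x * H + (2 * H ^ 2 - E) / x) + 2 * β * H)
      = α * (x * (M.γ * H) + M.γ * ((2 * H ^ 2 - E) / x)) + 2 * β * (M.γ * H) := by ring
  rw [h7, hH1]
  linarith

end TotalVariance

end MDP

/-! ### Anchors -/

section Anchor

variable {S A : Type*} [Fintype S] {M : MDP S A} {d K : ℕ} {φ : S → A → Fin d → ℝ}
  {anchor : Fin K → S × A} {lam : S → A → Fin K → ℝ}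

/-- P(·|s,a) is linear in φ(s,a), so the convex combination of features is a mixture of the anchor
laws. -/
lemma anchor_expect (hφ : M.AdmitsFeatures φ) (hl : IsAnchorCombination φ anchor lam)
    (s : S) (a : A) (u : S → ℝ) :
    ∑ k, lam s a k * expect (M.P (anchor k).1 (anchor k).2) u = expect (M.P s a) u := by
  obtain ⟨ψ, hψ⟩ := hφ
  have h1 : ∀ x, (M.P s a x).toReal
      = ∑ k, lam s a k * (M.P (anchor k).1 (anchor k).2 x).toReal := fun x => by
    have := hψ s a x
    rw [MDP.prob] at this
    rw [this, (hl s a).1]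
    have h2 : ∀ k, (M.P (anchor k).1 (anchor k).2 x).toReal
        = ∑ i, φ (anchor k).1 (anchor k).2 i * ψ i x := fun k => hψ _ _ x
    simp only [h2, Finset.sum_apply, Pi.smul_apply, smul_eq_mul, Finset.sum_mul, Finset.mul_sum]
    rw [Finset.sum_comm]
    simp only [mul_assoc]
  simp only [expect, h1, Finset.sum_mul, Finset.mul_sum]
  rw [Finset.sum_comm]
  simp only [mul_assoc]

/-- Law of total variance for this mixture: the variance of the anchor means is nonnegative. -/
lemma anchor_variance_le (hφ : M.AdmitsFeatures φ) (hl : IsAnchorCombination φ anchor lam)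
    (s : S) (a : A) (u : S → ℝ) :
    ∑ k, lam s a k * variance (M.P (anchor k).1 (anchor k).2) u ≤ variance (M.P s a) u := by
  set m : Fin K → ℝ := fun k => expect (M.P (anchor k).1 (anchor k).2) u with hm
  have h1 : ∑ k, lam s a k * m k = expect (M.P s a) u := anchor_expect hφ hl s a u
  have h2 := anchor_expect hφ hl s a fun x => u x ^ 2
  have h3 : expect (M.P s a) u ^ 2 ≤ ∑ k, lam s a k * m k ^ 2 := by
    have h4 : 0 ≤ ∑ k, lam s a k * (m k - expect (M.P s a) u) ^ 2 :=
      Finset.sum_nonneg fun k _ => mul_nonneg ((hl s a).2.2 k) (sq_nonneg _)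
    have h5 : ∑ k, lam s a k * (m k - expect (M.P s a) u) ^ 2
        = ∑ k, lam s a k * m k ^ 2 - 2 * expect (M.P s a) u * ∑ k, lam s a k * m k
          + expect (M.P s a) u ^ 2 * ∑ k, lam s a k := by
      rw [Finset.mul_sum, Finset.mul_sum, ← Finset.sum_sub_distrib, ← Finset.sum_add_distrib]
      exact Finset.sum_congr rfl fun k _ => by ring
    rw [h5, h1, (hl s a).2.1] at h4
    nlinarith
  simp only [variance, mul_sub, Finset.sum_sub_distrib]
  rw [h2]
  linarith

end Anchor

/-! ### Parametrised values -/

section ParamV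

variable {S A : Type*} {K : ℕ} {r : S → A → ℝ} {γ : ℝ} {lam : S → A → Fin K → ℝ}
  {θ θ' : Finset (Fin K → ℝ)}

lemma paramQ_le_paramV [Finite A] {w : Fin K → ℝ} (hw : w ∈ θ) (s : S) (a : A) :
    paramQ r γ lam w s a ≤ paramV r γ lam θ s := by
  have h1 : paramQ r γ lam w s a ≤ ⨆ a : A, paramQ r γ lam w s a :=
    le_ciSup (f := fun a => paramQ r γ lam w s a) (Set.toFinite _).bddAbove a
  exact h1.trans (le_ciSup (f := fun w : θ => ⨆ a : A, paramQ r γ lam w s a)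
    (Set.toFinite _).bddAbove ⟨w, hw⟩)

lemma exists_paramV_eq [Finite A] [Nonempty A] (hθ : θ.Nonempty) (s : S) :
    ∃ w ∈ θ, ∃ a, paramV r γ lam θ s = paramQ r γ lam w s a := by
  have : Nonempty θ := hθ.to_subtype
  obtain ⟨w, hw⟩ := exists_eq_ciSup_of_finite (f := fun w : θ => ⨆ a : A, paramQ r γ lam w s a)
  obtain ⟨a, ha⟩ := exists_eq_ciSup_of_finite (f := fun a : A => paramQ r γ lam w s a)
  exact ⟨w, w.2, a, by rw [paramV, ← hw, ← ha]⟩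

lemma exists_paramV_eq_policy [Finite A] [Nonempty A] (hθ : θ.Nonempty) {π : S → A}
    (hπ : IsParamPolicy r γ lam θ π) (s : S) :
    ∃ w ∈ θ, paramV r γ lam θ s = paramQ r γ lam w s (π s) := by
  have : Nonempty θ := hθ.to_subtype
  obtain ⟨w, hw, a, ha⟩ := exists_paramV_eq (r := r) (γ := γ) (lam := lam) hθ s
  obtain ⟨w', hw'⟩ := exists_eq_ciSup_of_finite (f := fun w : θ => paramQ r γ lam w s (π s))
  refine ⟨w', w'.2, le_antisymm ?_ (paramQ_le_paramV w'.2 s _)⟩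
  rw [ha, hw']
  exact (le_ciSup (f := fun w : θ => paramQ r γ lam w s a) (Set.toFinite _).bddAbove
    ⟨w, hw⟩).trans (hπ s a)

lemma exists_isParamPolicy [Finite A] [Nonempty A] (r : S → A → ℝ) (γ : ℝ)
    (lam : S → A → Fin K → ℝ) (θ : Finset (Fin K → ℝ)) :
    ∃ π : S → A, IsParamPolicy r γ lam θ π := by
  choose π hπ using fun s : S => Finite.exists_max fun a : A => ⨆ w : θ, paramQ r γ lam w s a
  exact ⟨π, hπ⟩

lemma paramV_mono [Finite A] [Nonempty A] (hθ : θ.Nonempty) (h : θ ⊆ θ') (s : S) :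
    paramV r γ lam θ s ≤ paramV r γ lam θ' s := by
  obtain ⟨w, hw, a, ha⟩ := exists_paramV_eq (r := r) (γ := γ) (lam := lam) hθ s
  rw [ha]
  exact paramQ_le_paramV (h hw) s a

/-- `θ` is nonempty and its vectors have entries in `[0, 1 / (1 - γ)]`. -/
def InRange (γ : ℝ) (θ : Finset (Fin K → ℝ)) : Prop :=
  θ.Nonempty ∧ ∀ w ∈ θ, ∀ k, w k ∈ Set.Icc 0 (1 - γ)⁻¹

lemma InRange.insert {w : Fin K → ℝ} (hθ : InRange γ θ) (hw : ∀ k, w k ∈ Set.Icc 0 (1 - γ)⁻¹) :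
    InRange γ (insert w θ) :=
  ⟨Finset.insert_nonempty _ _, fun w' hw' => by
    rcases Finset.mem_insert.mp hw' with rfl | h
    exacts [hw, hθ.2 w' h]⟩

end ParamV

/-! ### Range of V_θ and the invariant of estimation from below. -/

section Consistent

variable {S A : Type*} [Finite A] [Nonempty A] {M : MDP S A} {d K : ℕ}
  {φ : S → A → Fin d → ℝ} {anchor : Fin K → S × A} {lam : S → A → Fin K → ℝ}
  {θ : Finset (Fin K → ℝ)}

lemma paramV_mem (hl : IsAnchorCombination φ anchor lam) (hθ : InRange M.γ θ) (s : S) :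
    paramV M.r M.γ lam θ s ∈ Set.Icc 0 (1 - M.γ)⁻¹ := by
  obtain ⟨w, hw, a, ha⟩ := exists_paramV_eq (r := M.r) (γ := M.γ) (lam := lam) hθ.1 s
  have hγ := M.one_sub_γ_pos
  have h1 : 0 ≤ ∑ k, lam s a k * w k :=
    Finset.sum_nonneg fun k _ => mul_nonneg ((hl s a).2.2 k) (hθ.2 w hw k).1
  have h2 : ∑ k, lam s a k * w k ≤ (1 - M.γ)⁻¹ :=
    calc ∑ k, lam s a k * w k ≤ ∑ k, lam s a k * (1 - M.γ)⁻¹ :=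
          Finset.sum_le_sum fun k _ =>
            mul_le_mul_of_nonneg_left (hθ.2 w hw k).2 ((hl s a).2.2 k)
      _ = (1 - M.γ)⁻¹ := by rw [← Finset.sum_mul, (hl s a).2.1, one_mul]
  have h3 := mul_le_mul_of_nonneg_left h2 M.γ_pos.le
  have h4 : (1 - M.γ) * (1 - M.γ)⁻¹ = 1 := mul_inv_cancel₀ hγ.ne'
  have h5 := M.r_mem s a
  rw [ha, paramQ]
  exact ⟨add_nonneg h5.1 (mul_nonneg M.γ_pos.le h1), by linarith [h5.2]⟩

variable [Fintype S]

/-- Every vector of `θ` underestimates the expectations of `V_θ` at the anchors. -/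
def Underestimates (M : MDP S A) (anchor : Fin K → S × A) (lam : S → A → Fin K → ℝ)
    (θ : Finset (Fin K → ℝ)) : Prop :=
  ∀ w ∈ θ, ∀ k, w k ≤ expect (M.P (anchor k).1 (anchor k).2) (paramV M.r M.γ lam θ)

/-- Enlarging θ only raises V_θ, so bounds against the old V_θ remain valid. -/
lemma Underestimates.insert {w : Fin K → ℝ} (hne : θ.Nonempty)
    (hθ : Underestimates M anchor lam θ)
    (hw : ∀ k, w k ≤ expect (M.P (anchor k).1 (anchor k).2) (paramV M.r M.γ lam θ)) :
    Underestimates M anchor lam (insert w θ) := by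
  intro w' hw' k
  refine le_trans ?_ (expect_mono _ (paramV_mono hne (Finset.subset_insert w θ)))
  rcases Finset.mem_insert.mp hw' with rfl | h
  exacts [hw k, hθ w' h k]

/-- Monotonicity: the policy `π_θ` is at least as good as `V_θ`. -/
lemma Underestimates.paramV_le_value (hφ : M.AdmitsFeatures φ)
    (hl : IsAnchorCombination φ anchor lam) (hne : θ.Nonempty)
    (hθ : Underestimates M anchor lam θ) {π : S → A} (hπ : IsParamPolicy M.r M.γ lam θ π)
    (s : S) : paramV M.r M.γ lam θ s ≤ M.value π s := by
  refine M.le_value (fun s => ?_) s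
  obtain ⟨w, hw, h⟩ := exists_paramV_eq_policy hne hπ s
  rw [h, paramQ, ← anchor_expect hφ hl]
  have := Finset.sum_le_sum fun k (_ : k ∈ Finset.univ) =>
    mul_le_mul_of_nonneg_left (hθ w hw k) ((hl s (π s)).2.2 k)
  linarith [mul_le_mul_of_nonneg_left this M.γ_pos.le]

lemma Underestimates.paramV_le_optValue (hφ : M.AdmitsFeatures φ)
    (hl : IsAnchorCombination φ anchor lam) (hne : θ.Nonempty)
    (hθ : Underestimates M anchor lam θ) (s : S) :
    paramV M.r M.γ lam θ s ≤ M.optValue s := by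
  obtain ⟨π, hπ⟩ := exists_isParamPolicy M.r M.γ lam θ
  exact (hθ.paramV_le_value hφ hl hne hπ s).trans (M.value_le_optValue π s)

end Consistent

/-! ### Error propagation in one inner step. -/

section ApproximateStep

variable {S A : Type*} [Fintype S] [Finite A] {M : MDP S A} {d K : ℕ}
  {φ : S → A → Fin d → ℝ} {anchor : Fin K → S × A} {lam : S → A → Fin K → ℝ}
  {θ : Finset (Fin K → ℝ)}

/-- One step of approximate value iteration at the anchors. -/
lemma value_sub_paramV_insert_le (hφ : M.AdmitsFeatures φ)
    (hl : IsAnchorCombination φ anchor lam) {π : S → A} {α β x c : ℝ} (hα : 0 ≤ α)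
    (hβ : 0 ≤ β) (hx : 0 < x) {w : Fin K → ℝ}
    (hw : ∀ k, expect (M.P (anchor k).1 (anchor k).2) (paramV M.r M.γ lam θ)
      - 2 * (α * Real.sqrt (variance (M.P (anchor k).1 (anchor k).2) (M.value π)) + β) ≤ w k)
    (hθ : ∀ s, M.value π s - paramV M.r M.γ lam θ s ≤ c + M.varianceBound π α β x s) (s : S) :
    M.value π s - paramV M.r M.γ lam (insert w θ) s
      ≤ M.γ * c + M.varianceBound π α β x s := by
  have hγ := M.γ_pos
  have h1 := paramQ_le_paramV (r := M.r) (γ := M.γ) (lam := lam)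
    (Finset.mem_insert_self w θ) s (π s)
  set p : Fin K → PMF S := fun k => M.P (anchor k).1 (anchor k).2 with hp
  have h2 : ∀ k, M.γ * (expect (p k) (paramV M.r M.γ lam θ) - w k)
      ≤ α * (x + M.γ ^ 2 * variance (p k) (M.value π) / x) + 2 * β := fun k => by
    set v := variance (p k) (M.value π) with hv
    have hv0 : 0 ≤ v := variance_nonneg _ _
    have e1 : M.γ * (expect (p k) (paramV M.r M.γ lam θ) - w k)
        ≤ M.γ * (2 * (α * Real.sqrt v + β)) :=
      mul_le_mul_of_nonneg_left (by linarith [hw k]) hγ.le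
    -- Arithmetic-geometric mean with free parameter `x`. Variances, unlike their roots, can then be
    -- averaged directly with `anchor_variance_le`.
    have e2 : 2 * (M.γ * Real.sqrt v) ≤ x + M.γ ^ 2 * v / x := by
      have e3 : M.γ ^ 2 * v = (M.γ * Real.sqrt v) ^ 2 := by rw [mul_pow, Real.sq_sqrt hv0]
      rw [e3, ← sub_nonneg]
      have : x + (M.γ * Real.sqrt v) ^ 2 / x - 2 * (M.γ * Real.sqrt v)
          = (x - M.γ * Real.sqrt v) ^ 2 / x := by
        field_simp
        ring
      rw [this]
      positivity
    have e4 := mul_le_mul_of_nonneg_left e2 hα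
    have e5 : M.γ * β ≤ β := mul_le_of_le_one_left hβ M.γ_mem.2.le
    linarith
  have h3 := Finset.sum_le_sum fun k (_ : k ∈ Finset.univ) =>
    mul_le_mul_of_nonneg_left (h2 k) ((hl s (π s)).2.2 k)
  have h4 : ∑ k, lam s (π s) k * (M.γ * (expect (p k) (paramV M.r M.γ lam θ) - w k))
      = M.γ * expect (M.P s (π s)) (paramV M.r M.γ lam θ)
        - M.γ * ∑ k, lam s (π s) k * w k := by
    rw [← anchor_expect hφ hl, Finset.mul_sum, Finset.mul_sum, ← Finset.sum_sub_distrib]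
    exact Finset.sum_congr rfl fun k _ => by ring
  have h5 : ∑ k, lam s (π s) k * (α * (x + M.γ ^ 2 * variance (p k) (M.value π) / x) + 2 * β)
      = (α * x + 2 * β) * ∑ k, lam s (π s) k
        + α * M.γ ^ 2 / x * ∑ k, lam s (π s) k * variance (p k) (M.value π) := by
    rw [Finset.mul_sum, Finset.mul_sum, ← Finset.sum_add_distrib]
    exact Finset.sum_congr rfl fun k _ => by ring
  rw [h4, h5, (hl s (π s)).2.1] at h3
  have h6 := mul_le_mul_of_nonneg_left (anchor_variance_le hφ hl s (π s) (M.value π))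
    (show 0 ≤ α * M.γ ^ 2 / x by positivity)
  have h7 := expect_mono (M.P s (π s)) hθ
  rw [expect_sub, expect_add (M.P s (π s)) (fun _ => c), expect_const] at h7
  have h8 := mul_le_mul_of_nonneg_left h7 hγ.le
  have h9 := M.le_varianceBound π (β := β) hα hx s
  have h10 := M.value_eq π s
  rw [paramQ] at h1
  have h11 : α * M.γ ^ 2 / x * variance (M.P s (π s)) (M.value π)
      = α * (M.γ ^ 2 * variance (M.P s (π s)) (M.value π) / x) := by ring
  have h12 : expect (M.P s (π s)) (fun y => M.varianceBound π α β x y)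
      = expect (M.P s (π s)) (M.varianceBound π α β x) := rfl
  rw [h12] at h8
  rw [h11] at h6
  linarith

end ApproximateStep

/-! ### The loops of the algorithm -/

section Loops

variable {S A : Type*} {K : ℕ} {c : Constants} {r : S → A → ℝ} {γ : ℝ}
  {lam : S → A → Fin K → ℝ} {ε δ : ℝ}

lemma newParam_mem (hγ : 0 < 1 - γ) (i : ℕ) (θ₀ : Finset (Fin K → ℝ))
    (x₀ : Fin K → Fin (outerBatch c K γ ε δ) → S) (θ : Finset (Fin K → ℝ))
    (x : Fin K → Fin (innerBatch c K γ ε δ) → S) (k : Fin K) :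
    newParam c r γ lam ε δ i θ₀ x₀ θ x k ∈ Set.Icc 0 (1 - γ)⁻¹ :=
  ⟨le_max_left _ _, max_le (inv_pos.mpr hγ).le (min_le_right _ _)⟩

lemma InRange.innerLoop (hγ : 0 < 1 - γ) (ω : Query c K γ ε δ → S)
    (i : Fin (numOuter c γ ε + 1)) {θ₀ : Finset (Fin K → ℝ)} (hθ₀ : InRange γ θ₀) (j : ℕ)
    (hj : j ≤ numInner c γ ε) : InRange γ (innerLoop c r γ lam ε δ ω i θ₀ j hj) := by
  induction j with
  | zero => exact hθ₀
  | succ j ih => exact (ih (Nat.le_of_succ_le hj)).insert (newParam_mem hγ _ _ _ _ _)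

lemma inRange_outerLoop (hγ : 0 < 1 - γ) (ω : Query c K γ ε δ → S) (i : ℕ)
    (hi : i ≤ numOuter c γ ε + 1) : InRange γ (outerLoop c r γ lam ε δ ω i hi) := by
  induction i with
  | zero =>
    refine ⟨Finset.singleton_nonempty 0, fun w hw k => ?_⟩
    rw [Finset.mem_singleton.mp hw]
    exact ⟨le_rfl, (inv_pos.mpr hγ).le⟩
  | succ i ih => exact (ih (Nat.le_of_succ_le hi)).innerLoop hγ _ _ _ _

lemma subset_innerLoop (ω : Query c K γ ε δ → S)
    (i : Fin (numOuter c γ ε + 1)) (θ₀ : Finset (Fin K → ℝ)) (j : ℕ)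
    (hj : j ≤ numInner c γ ε) : θ₀ ⊆ innerLoop c r γ lam ε δ ω i θ₀ j hj := by
  induction j with
  | zero => exact Finset.Subset.refl _
  | succ j ih => exact (ih (Nat.le_of_succ_le hj)).trans (Finset.subset_insert _ _)

/-- The parameter after `j` inner steps uses inner batches with index below `j` only, so batch `j`
is independent of it. -/
lemma innerLoop_congr {ω ω' : Query c K γ ε δ → S} (i : Fin (numOuter c γ ε + 1))
    (θ₀ : Finset (Fin K → ℝ)) (j : ℕ) (hj : j ≤ numInner c γ ε)
    (h0 : ∀ k l, ω (i, k, Sum.inl l) = ω' (i, k, Sum.inl l))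
    (h1 : ∀ k (j' : Fin (numInner c γ ε)) l, (j' : ℕ) < j →
      ω (i, k, Sum.inr (j', l)) = ω' (i, k, Sum.inr (j', l))) :
    innerLoop c r γ lam ε δ ω i θ₀ j hj = innerLoop c r γ lam ε δ ω' i θ₀ j hj := by
  induction j with
  | zero => rfl
  | succ j ih =>
    have e := ih (Nat.le_of_succ_le hj) fun k j' l hlt => h1 k j' l (hlt.trans j.lt_succ_self)
    simp only [innerLoop, e, h0]
    congr 2
    funext k l
    exact h1 k ⟨j, hj⟩ l j.lt_succ_self

lemma outerLoop_congr {ω ω' : Query c K γ ε δ → S} (i : ℕ) (hi : i ≤ numOuter c γ ε + 1)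
    (h : ∀ q : Query c K γ ε δ, (q.1 : ℕ) < i → ω q = ω' q) :
    outerLoop c r γ lam ε δ ω i hi = outerLoop c r γ lam ε δ ω' i hi := by
  induction i with
  | zero => rfl
  | succ i ih =>
    simp only [outerLoop, ih (Nat.le_of_succ_le hi) fun q hq => h q (hq.trans i.lt_succ_self)]
    exact innerLoop_congr _ _ _ _ (fun k l => h _ i.lt_succ_self)
      fun k j' l _ => h _ i.lt_succ_self

end Loops

/-! ### Choice of the constants and the resulting sizes -/

/-- The constants for which the guarantee is proved. -/
def goodConstants : Constants where
  -- `cOuter` makes 2^{-R'} H ≤ ε, and `cInner` gives R ≥ 4H, hence γ^R ≤ 1/4. `cRef` is what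
  -- `confidence_bound` needs. `cOff` is 4·√4, from `bernstein_range` with L = 4ℓ. `cBatch` leaves
  -- room for all error terms.
  cOuter := 1 / Real.log 2
  cInner := 4
  cBatch := 10 ^ 8
  cRef := 32
  cOff := 8

lemma goodConstants_pos : goodConstants.Pos where
  cOuter := one_div_pos.mpr (Real.log_pos one_lt_two)
  cInner := by norm_num [goodConstants]
  cBatch := by norm_num [goodConstants]
  cRef := by norm_num [goodConstants]
  cOff := by norm_num [goodConstants]

section Sizes

variable {K : ℕ} {γ ε δ : ℝ}

lemma one_lt_inv_eps (hγ : γ ∈ Set.Ioo (0 : ℝ) 1) (hε : ε ∈ Set.Ioo (0 : ℝ) 1) :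
    1 < 1 / (ε * (1 - γ)) := by
  have h1 : 0 < 1 - γ := sub_pos.mpr hγ.2
  have h2 : ε * (1 - γ) < 1 := by nlinarith [hε.1, hε.2, hγ.1]
  rw [one_lt_div (mul_pos hε.1 h1)]
  exact h2

lemma log_inv_eps_pos (hγ : γ ∈ Set.Ioo (0 : ℝ) 1) (hε : ε ∈ Set.Ioo (0 : ℝ) 1) :
    0 < Real.log (1 / (ε * (1 - γ))) := Real.log_pos (one_lt_inv_eps hγ hε)

lemma one_le_numOuter (hγ : γ ∈ Set.Ioo (0 : ℝ) 1) (hε : ε ∈ Set.Ioo (0 : ℝ) 1) :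
    1 ≤ numOuter goodConstants γ ε :=
  Nat.one_le_ceil_iff.mpr (mul_pos goodConstants_pos.cOuter (log_inv_eps_pos hγ hε))

lemma numOuter_lt (hγ : γ ∈ Set.Ioo (0 : ℝ) 1) (hε : ε ∈ Set.Ioo (0 : ℝ) 1) :
    (numOuter goodConstants γ ε : ℝ) < 1 / Real.log 2 * Real.log (1 / (ε * (1 - γ))) + 1 :=
  Nat.ceil_lt_add_one (mul_pos goodConstants_pos.cOuter (log_inv_eps_pos hγ hε)).le

lemma le_numOuter : 1 / Real.log 2 * Real.log (1 / (ε * (1 - γ))) ≤ numOuter goodConstants γ ε :=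
  Nat.le_ceil _

lemma four_mul_numOuter_le_numInner :
    4 * (numOuter goodConstants γ ε : ℝ) * (1 - γ)⁻¹ ≤ numInner goodConstants γ ε := by
  refine le_trans (le_of_eq ?_) (Nat.le_ceil _)
  rw [mul_assoc, ← div_eq_mul_inv]
  rfl

lemma four_mul_inv_le_numInner (hγ : γ ∈ Set.Ioo (0 : ℝ) 1) (hε : ε ∈ Set.Ioo (0 : ℝ) 1) :
    4 * (1 - γ)⁻¹ ≤ numInner goodConstants γ ε := by
  have h1 : (1 : ℝ) ≤ numOuter goodConstants γ ε := by exact_mod_cast one_le_numOuter hγ hε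
  have h2 : 0 < (1 - γ)⁻¹ := inv_pos.mpr (sub_pos.mpr hγ.2)
  refine le_trans ?_ four_mul_numOuter_le_numInner
  gcongr
  linarith

lemma one_le_inv_one_sub (hγ : γ ∈ Set.Ioo (0 : ℝ) 1) : 1 ≤ (1 - γ)⁻¹ :=
  (one_le_inv₀ (sub_pos.mpr hγ.2)).mpr (by linarith [hγ.1])

lemma four_le_numInner (hγ : γ ∈ Set.Ioo (0 : ℝ) 1) (hε : ε ∈ Set.Ioo (0 : ℝ) 1) :
    (4 : ℝ) ≤ numInner goodConstants γ ε := by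
  linarith [four_mul_inv_le_numInner hγ hε, one_le_inv_one_sub hγ]

/-- The last accuracy level is at most `ε`. -/
lemma half_pow_numOuter_le (hγ : γ ∈ Set.Ioo (0 : ℝ) 1) (hε : ε ∈ Set.Ioo (0 : ℝ) 1) :
    (1 / 2 : ℝ) ^ numOuter goodConstants γ ε * (1 - γ)⁻¹ ≤ ε := by
  have h1 : 0 < 1 - γ := sub_pos.mpr hγ.2
  have h2 : 0 < Real.log 2 := Real.log_pos one_lt_two
  have h3 : 1 / (ε * (1 - γ)) ≤ 2 ^ numOuter goodConstants γ ε := by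
    have h4 := le_numOuter (γ := γ) (ε := ε)
    rw [one_div_mul_eq_div, div_le_iff₀ h2, ← Real.log_pow] at h4
    exact (Real.log_le_log_iff (zero_lt_one.trans (one_lt_inv_eps hγ hε)) (by positivity)).mp h4
  rw [div_le_iff₀ (mul_pos hε.1 h1)] at h3
  rw [one_div, inv_pow, ← mul_inv]
  rw [inv_le_iff_one_le_mul₀ (by positivity)]
  linarith

/-- No accuracy level is much smaller than `ε`. -/
lemma eps_le_half_pow (hγ : γ ∈ Set.Ioo (0 : ℝ) 1) (hε : ε ∈ Set.Ioo (0 : ℝ) 1) {i : ℕ}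
    (hi : i ≤ numOuter goodConstants γ ε) : ε ≤ 2 * ((1 / 2 : ℝ) ^ i * (1 - γ)⁻¹) := by
  have h1 : 0 < 1 - γ := sub_pos.mpr hγ.2
  have h2 : 0 < Real.log 2 := Real.log_pos one_lt_two
  have h3 : (2 : ℝ) ^ numOuter goodConstants γ ε ≤ 2 * (1 / (ε * (1 - γ))) := by
    have h4 := numOuter_lt hγ hε
    rw [one_div_mul_eq_div, ← sub_lt_iff_lt_add, lt_div_iff₀ h2, sub_mul, one_mul,
      ← Real.log_pow, sub_lt_iff_lt_add, add_comm] at h4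
    have h0 := zero_lt_one.trans (one_lt_inv_eps hγ hε)
    rw [← Real.log_mul two_ne_zero h0.ne'] at h4
    exact ((Real.log_lt_log_iff (by positivity) (by positivity)).mp h4).le
  have h4 : (2 : ℝ) ^ i ≤ 2 ^ numOuter goodConstants γ ε :=
    pow_le_pow_right₀ one_le_two hi
  have h5 := h4.trans h3
  rw [mul_one_div, le_div_iff₀ (mul_pos hε.1 h1)] at h5
  rw [one_div, inv_pow, ← mul_inv, ← div_eq_mul_inv, le_div_iff₀ (by positivity)]
  linarith

lemma pow_numInner_le (hγ : γ ∈ Set.Ioo (0 : ℝ) 1) (hε : ε ∈ Set.Ioo (0 : ℝ) 1) :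
    γ ^ numInner goodConstants γ ε ≤ 1 / 4 := by
  have h1 : 0 < 1 - γ := sub_pos.mpr hγ.2
  have h2 : γ ≤ Real.exp (-(1 - γ)) := by
    have := Real.add_one_le_exp (-(1 - γ))
    linarith
  have h3 := four_mul_inv_le_numInner hγ hε
  have h4 : 4 ≤ (numInner goodConstants γ ε : ℝ) * (1 - γ) := by
    rwa [← div_eq_mul_inv, div_le_iff₀ h1] at h3
  calc γ ^ numInner goodConstants γ ε ≤ Real.exp (-(1 - γ)) ^ numInner goodConstants γ ε :=
        pow_le_pow_left₀ hγ.1.le h2 _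
    _ = Real.exp (-(numInner goodConstants γ ε * (1 - γ))) := by
        rw [← Real.exp_nat_mul]
        ring_nf
    _ ≤ Real.exp (-4) := Real.exp_le_exp.mpr (by linarith)
    _ ≤ 1 / 4 := by
        rw [Real.exp_neg, one_div]
        exact inv_anti₀ (by norm_num) (by linarith [Real.add_one_le_exp (4 : ℝ)])

lemma logTerm_arg_pos (hγ : γ ∈ Set.Ioo (0 : ℝ) 1) (hε : ε ∈ Set.Ioo (0 : ℝ) 1)
    (hδ : δ ∈ Set.Ioo (0 : ℝ) 1) (hK : 1 ≤ K) :
    0 < (numOuter goodConstants γ ε : ℝ) * numInner goodConstants γ ε * K / δ := by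
  have h1 : (1 : ℝ) ≤ numOuter goodConstants γ ε := by exact_mod_cast one_le_numOuter hγ hε
  have h2 := four_le_numInner hγ hε
  have h3 : (1 : ℝ) ≤ K := by exact_mod_cast hK
  have := hδ.1
  positivity

/-- R'R ≥ 4H, and log 4 ≥ 1 supplies the summand 1. -/
lemma le_logTerm (hγ : γ ∈ Set.Ioo (0 : ℝ) 1) (hε : ε ∈ Set.Ioo (0 : ℝ) 1)
    (hδ : δ ∈ Set.Ioo (0 : ℝ) 1) (hK : 1 ≤ K) :
    1 + Real.log (K / (δ * (1 - γ))) ≤ logTerm goodConstants K γ ε δ := by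
  have hγ1 : 0 < 1 - γ := sub_pos.mpr hγ.2
  have h1 : (1 : ℝ) ≤ numOuter goodConstants γ ε := by exact_mod_cast one_le_numOuter hγ hε
  have h2 := four_mul_inv_le_numInner hγ hε
  have h3 : (1 : ℝ) ≤ K := by exact_mod_cast hK
  have hδ0 := hδ.1
  have h4 : 1 ≤ Real.log 4 := by
    rw [Real.le_log_iff_exp_le (by norm_num)]
    linarith [Real.exp_one_lt_d9]
  have h5 : Real.log (4 * (K / (δ * (1 - γ)))) ≤ logTerm goodConstants K γ ε δ := by
    refine Real.log_le_log (by positivity) ?_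
    have e1 : 4 * (K / (δ * (1 - γ))) = 1 * (4 * (1 - γ)⁻¹) * K / δ := by
      field_simp
    rw [e1]
    have : 0 < (1 - γ)⁻¹ := inv_pos.mpr hγ1
    gcongr
  rw [Real.log_mul (by norm_num) (by positivity)] at h5
  linarith

lemma log_failure_nonneg (hγ : γ ∈ Set.Ioo (0 : ℝ) 1)
    (hδ : δ ∈ Set.Ioo (0 : ℝ) 1) (hK : 1 ≤ K) : 0 ≤ Real.log (K / (δ * (1 - γ))) := by
  have hγ1 : 0 < 1 - γ := sub_pos.mpr hγ.2
  have h3 : (1 : ℝ) ≤ K := by exact_mod_cast hK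
  refine Real.log_nonneg ?_
  rw [one_le_div (mul_pos hδ.1 hγ1)]
  nlinarith [hδ.1, hδ.2, hγ.1]

lemma one_le_logTerm (hγ : γ ∈ Set.Ioo (0 : ℝ) 1) (hε : ε ∈ Set.Ioo (0 : ℝ) 1)
    (hδ : δ ∈ Set.Ioo (0 : ℝ) 1) (hK : 1 ≤ K) : 1 ≤ logTerm goodConstants K γ ε δ := by
  linarith [le_logTerm hγ hε hδ hK, log_failure_nonneg hγ hδ hK]

lemma le_outerBatch : 10 ^ 8 * (1 / ε ^ 2) *
    (logTerm goodConstants K γ ε δ ^ (4 / 3 : ℝ) * (1 - γ)⁻¹ ^ 3)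
      ≤ outerBatch goodConstants K γ ε δ := by
  refine le_trans (le_of_eq ?_) (Nat.le_ceil _)
  rw [inv_pow, ← div_eq_mul_inv]
  rfl

lemma le_innerBatch : 10 ^ 8 * (logTerm goodConstants K γ ε δ * (1 - γ)⁻¹ ^ 2)
      ≤ innerBatch goodConstants K γ ε δ := by
  refine le_trans (le_of_eq ?_) (Nat.le_ceil _)
  rw [inv_pow, ← div_eq_mul_inv]
  rfl

lemma logTerm_le_rpow (hγ : γ ∈ Set.Ioo (0 : ℝ) 1) (hε : ε ∈ Set.Ioo (0 : ℝ) 1)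
    (hδ : δ ∈ Set.Ioo (0 : ℝ) 1) (hK : 1 ≤ K) :
    logTerm goodConstants K γ ε δ ≤ logTerm goodConstants K γ ε δ ^ (4 / 3 : ℝ) := by
  conv_lhs => rw [← Real.rpow_one (logTerm goodConstants K γ ε δ)]
  exact Real.rpow_le_rpow_of_exponent_le (one_le_logTerm hγ hε hδ hK) (by norm_num)

/-- This is the condition `L ≤ n` of `bernstein_range` with L = 4ℓ. -/
lemma le_innerBatch' (hγ : γ ∈ Set.Ioo (0 : ℝ) 1) (hε : ε ∈ Set.Ioo (0 : ℝ) 1)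
    (hδ : δ ∈ Set.Ioo (0 : ℝ) 1) (hK : 1 ≤ K) :
    4 * logTerm goodConstants K γ ε δ ≤ innerBatch goodConstants K γ ε δ := by
  have h1 := one_le_logTerm hγ hε hδ hK
  refine le_trans ?_ le_innerBatch
  have h2 : 1 ≤ (1 - γ)⁻¹ ^ 2 := one_le_pow₀ (one_le_inv_one_sub hγ)
  nlinarith

lemma le_outerBatch' (hγ : γ ∈ Set.Ioo (0 : ℝ) 1) (hε : ε ∈ Set.Ioo (0 : ℝ) 1)
    (hδ : δ ∈ Set.Ioo (0 : ℝ) 1) (hK : 1 ≤ K) :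
    4 * logTerm goodConstants K γ ε δ ≤ outerBatch goodConstants K γ ε δ := by
  have h1 := one_le_logTerm hγ hε hδ hK
  refine le_trans ?_ le_outerBatch
  have h2 : 1 ≤ (1 - γ)⁻¹ ^ 3 := one_le_pow₀ (one_le_inv_one_sub hγ)
  have h3 := logTerm_le_rpow hγ hε hδ hK
  have h4 : 1 ≤ 1 / ε ^ 2 := by
    rw [one_le_div (pow_pos hε.1 2)]
    exact pow_le_one₀ hε.1.le hε.2.le
  have h5 : logTerm goodConstants K γ ε δ
      ≤ logTerm goodConstants K γ ε δ ^ (4 / 3 : ℝ) * (1 - γ)⁻¹ ^ 3 := by nlinarith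
  nlinarith

/-! ### The number of samples -/

lemma numSamples_eq (c : Constants) : numSamples c K γ ε δ = (numOuter c γ ε + 1) *
    (K * (outerBatch c K γ ε δ + numInner c γ ε * innerBatch c K γ ε δ)) := by
  simp only [numSamples, Query, Fintype.card_prod, Fintype.card_sum, Fintype.card_fin]

lemma le_numSamples (hγ : γ ∈ Set.Ioo (0 : ℝ) 1) (hε : ε ∈ Set.Ioo (0 : ℝ) 1)
    (hδ : δ ∈ Set.Ioo (0 : ℝ) 1) (hK : 1 ≤ K) :
    1 * (K / ((1 - γ) ^ 3 * ε ^ 2)) * (1 + Real.log (K / (δ * (1 - γ)))) ^ (4 / 3 : ℝ) *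
        (1 + Real.log (1 / (ε * (1 - γ)))) ≤ (numSamples goodConstants K γ ε δ : ℝ) := by
  have hγ1 : 0 < 1 - γ := sub_pos.mpr hγ.2
  have hε0 := hε.1
  have h3 : (1 : ℝ) ≤ K := by exact_mod_cast hK
  have hΛ := log_inv_eps_pos hγ hε
  set Λ := Real.log (1 / (ε * (1 - γ))) with hΛdef
  have h1 : 1 + Λ ≤ numOuter goodConstants γ ε + 1 := by
    have h2 := le_numOuter (γ := γ) (ε := ε)
    have h4 : 1 ≤ 1 / Real.log 2 := by
      rw [one_le_div (Real.log_pos one_lt_two)]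
      linarith [Real.log_two_lt_d9]
    nlinarith
  have h5 : (1 + Real.log (K / (δ * (1 - γ)))) ^ (4 / 3 : ℝ)
      ≤ logTerm goodConstants K γ ε δ ^ (4 / 3 : ℝ) :=
    Real.rpow_le_rpow (by linarith [log_failure_nonneg hγ hδ hK]) (le_logTerm hγ hε hδ hK)
      (by norm_num)
  set Y := (1 + Real.log (K / (δ * (1 - γ)))) ^ (4 / 3 : ℝ) with hY
  have hY0 : 0 ≤ Y := Real.rpow_nonneg (by linarith [log_failure_nonneg hγ hδ hK]) _
  have h6 : 1 / ε ^ 2 * (Y * (1 - γ)⁻¹ ^ 3) ≤ outerBatch goodConstants K γ ε δ := by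
    refine le_trans ?_ le_outerBatch
    have h7 : 0 < (1 - γ)⁻¹ := inv_pos.mpr hγ1
    gcongr
    nlinarith [show 0 < 1 / ε ^ 2 by positivity]
  rw [numSamples_eq]
  push_cast
  -- The reference batches alone give the lower bound; the inner batches are dropped.
  have h8 : (0 : ℝ) ≤ numInner goodConstants γ ε * innerBatch goodConstants K γ ε δ := by
    positivity
  calc 1 * (K / ((1 - γ) ^ 3 * ε ^ 2)) * Y * (1 + Λ)
      = (1 + Λ) * (K * (1 / ε ^ 2 * (Y * (1 - γ)⁻¹ ^ 3))) := by
        rw [inv_pow]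
        field_simp
    _ ≤ _ := by
        gcongr
        linarith

/-- With X = 1/(ε(1-γ)) and Y = K/(εδ(1-γ)), the bound 1 + log X ≤ X makes the argument of the
logarithm at most 18 X²·HK/δ ≤ 18 Y³, and log 18 ≤ 3. -/
lemma logTerm_le (hγ : γ ∈ Set.Ioo (0 : ℝ) 1) (hε : ε ∈ Set.Ioo (0 : ℝ) 1)
    (hδ : δ ∈ Set.Ioo (0 : ℝ) 1) (hK : 1 ≤ K) (h1 : (numOuter goodConstants γ ε : ℝ) ≤
      2 * (1 + Real.log (1 / (ε * (1 - γ))))) (h2 : (numInner goodConstants γ ε : ℝ) ≤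
      9 * (1 + Real.log (1 / (ε * (1 - γ)))) * (1 - γ)⁻¹) :
    logTerm goodConstants K γ ε δ ≤ 3 * (1 + Real.log (K / (ε * δ * (1 - γ)))) := by
  have hγ1 : 0 < 1 - γ := sub_pos.mpr hγ.2
  have hγ0 := hγ.1
  have hε0 := hε.1
  have hδ0 := hδ.1
  have hK1 : (1 : ℝ) ≤ K := by exact_mod_cast hK
  have hX := one_lt_inv_eps hγ hε
  set X := 1 / (ε * (1 - γ)) with hXdef
  have hΛ : 1 + Real.log X ≤ X := by linarith [Real.log_le_sub_one_of_pos (zero_lt_one.trans hX)]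
  have hΛ0 := log_inv_eps_pos hγ hε
  set Y := K / (ε * δ * (1 - γ)) with hYdef
  have hXY : X ≤ Y := by
    rw [hXdef, hYdef, div_le_div_iff₀ (by positivity) (by positivity)]
    have : δ ≤ K := by linarith [hδ.2]
    nlinarith [mul_pos hε0 hγ1]
  have hHY : (1 - γ)⁻¹ * K / δ ≤ Y := by
    have : (1 - γ)⁻¹ * K / δ = K / (1 * δ * (1 - γ)) := by field_simp
    rw [this, hYdef]
    gcongr
    exact hε.2.le
  have hY0 : 0 < Y := by positivity
  have h3 : (numOuter goodConstants γ ε : ℝ) * numInner goodConstants γ ε * K / δ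
      ≤ 18 * Y ^ 3 :=
    calc (numOuter goodConstants γ ε : ℝ) * numInner goodConstants γ ε * K / δ
        ≤ (2 * X) * (9 * X * (1 - γ)⁻¹) * K / δ := by
          have : 0 < (1 - γ)⁻¹ := inv_pos.mpr hγ1
          gcongr
          · linarith
          · exact h2.trans (by gcongr)
      _ = 18 * X ^ 2 * ((1 - γ)⁻¹ * K / δ) := by ring
      _ ≤ 18 * Y ^ 2 * Y := by gcongr
      _ = 18 * Y ^ 3 := by ring
  have h4 := Real.log_le_log (logTerm_arg_pos hγ hε hδ hK) h3
  rw [Real.log_mul (by norm_num) (by positivity), Real.log_pow] at h4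
  have h5 : Real.log 18 ≤ 3 := by
    rw [Real.log_le_iff_le_exp (by norm_num)]
    have h6 : Real.exp 3 = Real.exp 1 ^ 3 := by rw [← Real.exp_nat_mul]; norm_num
    rw [h6]
    calc (18 : ℝ) ≤ 2.7 ^ 3 := by norm_num
      _ ≤ _ := by
        gcongr
        linarith [Real.exp_one_gt_d9]
  push_cast at h4
  rw [logTerm]
  linarith

lemma numSamples_le (hγ : γ ∈ Set.Ioo (0 : ℝ) 1) (hε : ε ∈ Set.Ioo (0 : ℝ) 1)
    (hδ : δ ∈ Set.Ioo (0 : ℝ) 1) (hK : 1 ≤ K) :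
    (numSamples goodConstants K γ ε δ : ℝ) ≤ 144 * 10 ^ 8 * (K / ((1 - γ) ^ 3 * ε ^ 2)) *
      (1 + Real.log (K / (ε * δ * (1 - γ)))) ^ (4 / 3 : ℝ) *
        (1 + Real.log (1 / (ε * (1 - γ)))) ^ 2 := by
  have hγ1 : 0 < 1 - γ := sub_pos.mpr hγ.2
  have hε0 := hε.1
  have hK1 : (1 : ℝ) ≤ K := by exact_mod_cast hK
  have hΛ := log_inv_eps_pos hγ hε
  set Λ := Real.log (1 / (ε * (1 - γ))) with hΛdef
  have hH := one_le_inv_one_sub hγ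
  set H := (1 - γ)⁻¹ with hHdef
  have hR' : (numOuter goodConstants γ ε : ℝ) + 1 ≤ 2 * (1 + Λ) := by
    have h2 := numOuter_lt hγ hε
    have h4 : 1 / Real.log 2 ≤ 2 := by
      rw [div_le_iff₀ (Real.log_pos one_lt_two)]
      linarith [Real.log_two_gt_d9]
    nlinarith
  have hR : (numInner goodConstants γ ε : ℝ) ≤ 9 * (1 + Λ) * H := by
    have h2 : (numInner goodConstants γ ε : ℝ) < 4 * (numOuter goodConstants γ ε / (1 - γ)) + 1 :=
      Nat.ceil_lt_add_one (mul_nonneg (by norm_num [goodConstants]) (by positivity))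
    rw [div_eq_mul_inv] at h2
    have h3 : (numOuter goodConstants γ ε : ℝ) * H ≤ (2 * (1 + Λ)) * H := by
      gcongr
      linarith
    nlinarith
  have hl := logTerm_le hγ hε hδ hK (by linarith) hR
  have hl1 := one_le_logTerm hγ hε hδ hK
  have hl2 := logTerm_le_rpow hγ hε hδ hK
  set l := logTerm goodConstants K γ ε δ with hldef
  set y := 1 + Real.log (K / (ε * δ * (1 - γ))) with hy
  have hy0 : 0 ≤ y := by linarith
  have hl3 : l ^ (4 / 3 : ℝ) ≤ 9 * y ^ (4 / 3 : ℝ) := by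
    calc l ^ (4 / 3 : ℝ) ≤ (3 * y) ^ (4 / 3 : ℝ) :=
          Real.rpow_le_rpow (by linarith) hl (by norm_num)
      _ = 3 ^ (4 / 3 : ℝ) * y ^ (4 / 3 : ℝ) := Real.mul_rpow (by norm_num) hy0
      _ ≤ 3 ^ (2 : ℝ) * y ^ (4 / 3 : ℝ) := by
          gcongr
          · norm_num
          · norm_num
      _ = 9 * y ^ (4 / 3 : ℝ) := by norm_num
  set Y := y ^ (4 / 3 : ℝ) with hY
  have hY0 : 0 ≤ Y := Real.rpow_nonneg hy0 _
  have h1e : 1 ≤ 1 / ε ^ 2 := by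
    rw [one_le_div (pow_pos hε.1 2)]
    exact pow_le_one₀ hε.1.le hε.2.le
  set E := 1 / ε ^ 2 with hE
  have hm : (outerBatch goodConstants K γ ε δ : ℝ) ≤ 2 * 10 ^ 8 * E * (l ^ (4 / 3 : ℝ) * H ^ 3) := by
    have h2 : (outerBatch goodConstants K γ ε δ : ℝ)
        < 10 ^ 8 * E * (l ^ (4 / 3 : ℝ) / (1 - γ) ^ 3) + 1 :=
      Nat.ceil_lt_add_one (by unfold goodConstants; positivity)
    rw [div_eq_mul_inv, ← inv_pow] at h2
    have h3 : 1 ≤ E * (l ^ (4 / 3 : ℝ) * H ^ 3) :=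
      one_le_mul_of_one_le_of_one_le h1e
        (one_le_mul_of_one_le_of_one_le (hl1.trans hl2) (one_le_pow₀ hH))
    nlinarith
  have hm1 : (innerBatch goodConstants K γ ε δ : ℝ) ≤ 2 * 10 ^ 8 * (l * H ^ 2) := by
    have h2 : (innerBatch goodConstants K γ ε δ : ℝ) < 10 ^ 8 * (l / (1 - γ) ^ 2) + 1 :=
      Nat.ceil_lt_add_one (by unfold goodConstants; positivity)
    rw [div_eq_mul_inv, ← inv_pow] at h2
    have h3 : 1 ≤ l * H ^ 2 := one_le_mul_of_one_le_of_one_le hl1 (one_le_pow₀ hH)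
    nlinarith
  have hy1 : l ≤ 3 * Y := by
    have hyy : 1 ≤ y := by
      refine le_add_of_nonneg_right (Real.log_nonneg ?_)
      rw [one_le_div (mul_pos (mul_pos hε0 hδ.1) hγ1)]
      have : ε * δ * (1 - γ) ≤ 1 := by
        have e1 : ε * δ ≤ 1 := mul_le_one₀ hε.2.le hδ.1.le hδ.2.le
        exact mul_le_one₀ e1 hγ1.le (by linarith [hγ.1])
      linarith
    have : y ≤ Y := by
      conv_lhs => rw [← Real.rpow_one y]
      exact Real.rpow_le_rpow_of_exponent_le hyy (by norm_num)
    linarith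
  have hm' : (outerBatch goodConstants K γ ε δ : ℝ) ≤ (1 + Λ) * (18 * 10 ^ 8 * E * H ^ 3 * Y) := by
    calc _ ≤ 2 * 10 ^ 8 * E * (l ^ (4 / 3 : ℝ) * H ^ 3) := hm
      _ ≤ 2 * 10 ^ 8 * E * ((9 * Y) * H ^ 3) := by gcongr
      _ = 1 * (18 * 10 ^ 8 * E * H ^ 3 * Y) := by ring
      _ ≤ _ := by
        gcongr
        linarith
  -- R contributes H and one factor 1 + Λ, `innerBatch` contributes H²; the factor ε^{-2} ≥ 1 is
  -- given away. The final constant is 144 = 2(18 + 54).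
  have hn' : (numInner goodConstants γ ε * innerBatch goodConstants K γ ε δ : ℝ)
      ≤ (1 + Λ) * (54 * 10 ^ 8 * E * H ^ 3 * Y) := by
    calc _ ≤ (9 * (1 + Λ) * H) * (2 * 10 ^ 8 * ((3 * Y) * H ^ 2)) := by
          gcongr
          exact hm1.trans (by gcongr)
      _ = 1 * ((1 + Λ) * (54 * 10 ^ 8 * H ^ 3 * Y)) := by ring
      _ ≤ E * ((1 + Λ) * (54 * 10 ^ 8 * H ^ 3 * Y)) := by gcongr
      _ = _ := by ring
  rw [numSamples_eq]
  push_cast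
  calc ((numOuter goodConstants γ ε : ℝ) + 1) * (K * (outerBatch goodConstants K γ ε δ
        + numInner goodConstants γ ε * innerBatch goodConstants K γ ε δ))
      ≤ (2 * (1 + Λ)) * (K * ((1 + Λ) * (18 * 10 ^ 8 * E * H ^ 3 * Y)
          + (1 + Λ) * (54 * 10 ^ 8 * E * H ^ 3 * Y))) := by gcongr
    _ = 144 * 10 ^ 8 * (K * (E * H ^ 3)) * Y * (1 + Λ) ^ 2 := by ring
    _ = _ := by
        rw [hE, hHdef, inv_pow]
        field_simp

end Sizes

/-! ### The confidence bound of the reference mean -/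

lemma empMean_mem {S : Type*} {n : ℕ} {f : S → ℝ} {b : ℝ} (hn : 0 < n)
    (hf : ∀ s, f s ∈ Set.Icc 0 b) (x : Fin n → S) : empMean f x ∈ Set.Icc 0 b := by
  have hn' : (0 : ℝ) < n := Nat.cast_pos.mpr hn
  refine ⟨div_nonneg (Finset.sum_nonneg fun l _ => (hf (x l)).1) hn'.le, ?_⟩
  rw [empMean, div_le_iff₀ hn']
  refine (Finset.sum_le_sum fun l _ => (hf (x l)).2).trans_eq ?_
  simp [mul_comm]

lemma sqrt_add_le_of_nonneg {a b c : ℝ} (hc : 0 ≤ c) (h : a ≤ b + c ^ 2) :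
    Real.sqrt a ≤ Real.sqrt b + c := by
  rw [Real.sqrt_le_iff]
  refine ⟨by positivity, ?_⟩
  -- No sign of `b` is assumed: the root of a negative number is 0.
  have h1 : b ≤ Real.sqrt b ^ 2 := by
    rcases le_total 0 b with hb | hb
    · rw [Real.sq_sqrt hb]
    · exact hb.trans (sq_nonneg _)
  nlinarith [mul_nonneg (Real.sqrt_nonneg b) hc]

/-- Here ℓ = u⁴, m = t⁴ and y = u/t = (ℓ/m)^{1/4}. The empirical variance is off by at most (8 +
16)H²y² ≤ (5Hy)², so the standard deviations differ by at most 5Hy. Multiplied by √(ℓ/m) = y², this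
is of order Hy³ ≤ ℓH m^{-3/4}, the second term of the confidence bound. For the first claim 20 + 8 ≤
32 such terms suffice. -/
lemma confidence_bound {H u t w z μ ν : ℝ} (hu : 1 ≤ u) (ht : 0 < t)
    (hut : 4 * u ^ 4 ≤ t ^ 4) (hw : w ∈ Set.Icc 0 H) (hμ : μ ∈ Set.Icc 0 H)
    (h1 : |w - μ| ≤ 2 * Real.sqrt ((ν - μ ^ 2) * (4 * u ^ 4) / t ^ 4) + 2 * H * (4 * u ^ 4) / t ^ 4)
    (h2 : |w - μ| ≤ 4 * H * Real.sqrt (4 * u ^ 4 / t ^ 4))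
    (h3 : |z - ν| ≤ 4 * H ^ 2 * Real.sqrt (4 * u ^ 4 / t ^ 4)) :
    |w - μ| ≤ 32 * (Real.sqrt (u ^ 4 * (z - w ^ 2) / t ^ 4) + u ^ 4 * H / t ^ 3) ∧
      32 * (Real.sqrt (u ^ 4 * (z - w ^ 2) / t ^ 4) + u ^ 4 * H / t ^ 3) ≤
        32 * (Real.sqrt (u ^ 4 / t ^ 4) * Real.sqrt (ν - μ ^ 2) + 6 * (u ^ 4 * H / t ^ 3)) := by
  have hu0 : 0 < u := by linarith
  have hH : 0 ≤ H := hw.1.trans hw.2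
  set y := u / t with hy
  have hy0 : 0 < y := div_pos hu0 ht
  have hy1 : y ≤ 1 := by
    rw [hy, div_le_one ht]
    exact le_of_pow_le_pow_left₀ (n := 4) (by norm_num) ht.le (by nlinarith [pow_pos hu0 4])
  have hy4 : u ^ 4 / t ^ 4 = y ^ 4 := (div_pow u t 4).symm
  have hs : Real.sqrt (y ^ 4) = y ^ 2 := by
    rw [show y ^ 4 = (y ^ 2) ^ 2 by ring, Real.sqrt_sq (by positivity)]
  have hs4 : Real.sqrt (4 * u ^ 4 / t ^ 4) = 2 * y ^ 2 := by
    rw [mul_div_assoc, hy4, show 4 * y ^ 4 = (2 * y ^ 2) ^ 2 by ring,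
      Real.sqrt_sq (by positivity)]
  have hρ : y ^ 3 * H ≤ u ^ 4 * H / t ^ 3 := by
    rw [hy, div_pow, div_mul_eq_mul_div]
    gcongr
    · norm_num
  have hsv : Real.sqrt ((ν - μ ^ 2) * (4 * u ^ 4) / t ^ 4)
      = 2 * y ^ 2 * Real.sqrt (ν - μ ^ 2) := by
    rw [mul_div_assoc, mul_comm, Real.sqrt_mul (by positivity), hs4]
  have hsσ : Real.sqrt (u ^ 4 * (z - w ^ 2) / t ^ 4) = y ^ 2 * Real.sqrt (z - w ^ 2) := by
    rw [mul_div_right_comm, hy4, Real.sqrt_mul (by positivity), hs]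
  have hL : 2 * H * (4 * u ^ 4) / t ^ 4 = 8 * H * y ^ 4 := by
    rw [← hy4]
    ring
  rw [hs4] at h2 h3
  rw [hsv, hL] at h1
  rw [hsσ, hy4, hs]
  have h4 : |z - w ^ 2 - (ν - μ ^ 2)| ≤ (5 * H * y) ^ 2 := by
    have e1 : z - w ^ 2 - (ν - μ ^ 2) = (z - ν) - (w - μ) * (w + μ) := by ring
    have e2 : |(w - μ) * (w + μ)| ≤ (4 * H * (2 * y ^ 2)) * (2 * H) := by
      rw [abs_mul]
      refine mul_le_mul h2 ?_ (abs_nonneg _) (by positivity)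
      rw [abs_of_nonneg (add_nonneg hw.1 hμ.1)]
      linarith [hw.2, hμ.2]
    rw [e1]
    refine (abs_sub _ _).trans ?_
    nlinarith [sq_nonneg (H * y)]
  have h5 := abs_le.mp h4
  have h6 : Real.sqrt (ν - μ ^ 2) ≤ Real.sqrt (z - w ^ 2) + 5 * H * y :=
    sqrt_add_le_of_nonneg (by positivity) (by linarith)
  have h7 : Real.sqrt (z - w ^ 2) ≤ Real.sqrt (ν - μ ^ 2) + 5 * H * y :=
    sqrt_add_le_of_nonneg (by positivity) (by linarith)
  have h8 : y ^ 2 * (5 * H * y) = 5 * (y ^ 3 * H) := by ring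
  have hy2 : 0 ≤ y ^ 2 := by positivity
  constructor
  · have h9 := mul_le_mul_of_nonneg_left h6 hy2
    have h10 : 8 * H * y ^ 4 ≤ 8 * (y ^ 3 * H) := by
      have : H * y ^ 3 * y ≤ H * y ^ 3 * 1 := by gcongr
      nlinarith
    have h11 : 0 ≤ y ^ 2 * Real.sqrt (z - w ^ 2) := by positivity
    have h12 : 0 ≤ y ^ 3 * H := by positivity
    nlinarith
  · have h9 := mul_le_mul_of_nonneg_left h7 hy2
    nlinarith

section RefErr

variable {S : Type*} [Fintype S] {n : ℕ}

/-- The empirical mean and the empirical second moment of `f` are accurate. -/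
def AccurateMoments (p : PMF S) (f : S → ℝ) (H L : ℝ) (x : Fin n → S) : Prop :=
  |empMean f x - expect p f| ≤ 2 * Real.sqrt (variance p f * L / n) + 2 * H * L / n ∧
    |empMean f x - expect p f| ≤ 4 * H * Real.sqrt (L / n) ∧
    |empMean (fun s => f s ^ 2) x - expect p fun s => f s ^ 2| ≤ 4 * H ^ 2 * Real.sqrt (L / n)

variable {A : Type*} [Finite A] [Nonempty A] {M : MDP S A} {d K : ℕ} {φ : S → A → Fin d → ℝ}
  {anchor : Fin K → S × A} {lam : S → A → Fin K → ℝ} {ε δ : ℝ} {θ : Finset (Fin K → ℝ)}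

lemma refErr_bound (hl : IsAnchorCombination φ anchor lam) (hθ : InRange M.γ θ) (p : PMF S)
    (hℓ : 1 ≤ logTerm goodConstants K M.γ ε δ)
    (hm : 4 * logTerm goodConstants K M.γ ε δ ≤ outerBatch goodConstants K M.γ ε δ)
    {x : Fin (outerBatch goodConstants K M.γ ε δ) → S}
    (hx : AccurateMoments p (paramV M.r M.γ lam θ) (1 - M.γ)⁻¹
      (4 * logTerm goodConstants K M.γ ε δ) x) :
    |refMean M.r M.γ lam θ x - expect p (paramV M.r M.γ lam θ)|
        ≤ refErr goodConstants M.r M.γ lam ε δ θ x ∧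
      refErr goodConstants M.r M.γ lam ε δ θ x ≤
        32 * (Real.sqrt (logTerm goodConstants K M.γ ε δ / outerBatch goodConstants K M.γ ε δ)
            * Real.sqrt (variance p (paramV M.r M.γ lam θ))
          + 6 * (logTerm goodConstants K M.γ ε δ * (1 - M.γ)⁻¹
            / (outerBatch goodConstants K M.γ ε δ : ℝ) ^ (3 / 4 : ℝ))) := by
  have hV := fun s => paramV_mem hl hθ s
  have hm0 : (0 : ℝ) < outerBatch goodConstants K M.γ ε δ := by linarith
  have hw := empMean_mem (Nat.cast_pos.mp hm0) hV x
  have hμ : expect p (paramV M.r M.γ lam θ) ∈ Set.Icc 0 (1 - M.γ)⁻¹ :=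
    ⟨expect_nonneg p fun s => (hV s).1, expect_le p fun s => (hV s).2⟩
  obtain ⟨h1, h2, h3⟩ := hx
  unfold refErr refVar refMean
  generalize logTerm goodConstants K M.γ ε δ = ℓ at *
  generalize hN : outerBatch goodConstants K M.γ ε δ = N at *
  obtain ⟨u, hu, rfl⟩ : ∃ u : ℝ, 1 ≤ u ∧ ℓ = u ^ 4 :=
    ⟨ℓ ^ (1 / 4 : ℝ), Real.one_le_rpow hℓ (by norm_num), by
      rw [← Real.rpow_natCast, ← Real.rpow_mul (by linarith)]
      norm_num⟩
  have hN1 : (N : ℝ) = ((N : ℝ) ^ (1 / 4 : ℝ)) ^ 4 := by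
    rw [← Real.rpow_natCast, ← Real.rpow_mul hm0.le]
    norm_num
  have hN2 : (N : ℝ) ^ (3 / 4 : ℝ) = ((N : ℝ) ^ (1 / 4 : ℝ)) ^ 3 := by
    rw [← Real.rpow_natCast, ← Real.rpow_mul hm0.le]
    norm_num
  have ht : 0 < (N : ℝ) ^ (1 / 4 : ℝ) := Real.rpow_pos_of_pos hm0 _
  rw [hN2]
  generalize (N : ℝ) ^ (1 / 4 : ℝ) = t at *
  rw [hN1] at h1 h2 h3 hm ⊢
  exact confidence_bound hu ht hm hw hμ h1 h2 h3

end RefErr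

/-! ### The size of the confidence bounds -/

section Batches

variable {S A : Type*} {M : MDP S A} {K : ℕ} {ε δ : ℝ}

/-- This is where m needs ℓ^{4/3}: the term ℓ m^{-3/4} is controlled by comparing m with the power
4/3 of ℓH²/ε. -/
lemma inv_rpow_outerBatch_le (hε : ε ∈ Set.Ioo (0 : ℝ) 1)
    (hℓ : 1 ≤ logTerm goodConstants K M.γ ε δ) :
    logTerm goodConstants K M.γ ε δ * (1 - M.γ)⁻¹ ^ 2
      / (outerBatch goodConstants K M.γ ε δ : ℝ) ^ (3 / 4 : ℝ) ≤ ε / 10 ^ 6 := by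
  have hm := le_outerBatch (K := K) (γ := M.γ) (ε := ε) (δ := δ)
  have hH := one_le_inv_one_sub M.γ_mem
  set H := (1 - M.γ)⁻¹
  set ℓ := logTerm goodConstants K M.γ ε δ
  set m : ℝ := (outerBatch goodConstants K M.γ ε δ : ℝ)
  have hε0 := hε.1
  have h1 : (10 ^ 6 * (1 / ε) * (ℓ * H ^ 2)) ≤ m ^ (3 / 4 : ℝ) := by
    have h2 : (10 ^ 6 * (1 / ε) * (ℓ * H ^ 2)) ^ (4 / 3 : ℝ) ≤ m := by
      refine le_trans ?_ hm
      rw [Real.mul_rpow (by positivity) (by positivity),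
        Real.mul_rpow (by positivity) (by positivity),
        Real.mul_rpow (by positivity) (by positivity)]
      have e1 : ((10 : ℝ) ^ 6) ^ (4 / 3 : ℝ) = 10 ^ 8 := by
        rw [← Real.rpow_natCast, ← Real.rpow_mul (by norm_num), ← Real.rpow_natCast]
        norm_num
      have e2 : (1 / ε) ^ (4 / 3 : ℝ) ≤ 1 / ε ^ 2 := by
        rw [← one_div_pow, ← Real.rpow_natCast]
        refine Real.rpow_le_rpow_of_exponent_le ?_ (by norm_num)
        rw [one_le_div hε0]
        exact hε.2.le
      have e3 : (H ^ 2) ^ (4 / 3 : ℝ) ≤ H ^ 3 := by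
        rw [← Real.rpow_natCast, ← Real.rpow_mul (by linarith), ← Real.rpow_natCast]
        exact Real.rpow_le_rpow_of_exponent_le hH (by norm_num)
      rw [e1]
      gcongr
    calc _ = ((10 ^ 6 * (1 / ε) * (ℓ * H ^ 2)) ^ (4 / 3 : ℝ)) ^ (3 / 4 : ℝ) := by
          rw [← Real.rpow_mul (by positivity)]
          norm_num
      _ ≤ _ := Real.rpow_le_rpow (by positivity) h2 (by norm_num)
  have h3 : 0 < m ^ (3 / 4 : ℝ) := lt_of_lt_of_le (by positivity) h1
  rw [div_le_iff₀ h3]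
  have h4 : ℓ * H ^ 2 = ε / 10 ^ 6 * (10 ^ 6 * (1 / ε) * (ℓ * H ^ 2)) := by field_simp
  rw [h4]
  gcongr

/-- The factor H^{3/2} is the accumulated standard deviation along a trajectory. -/
lemma sqrt_outerBatch_le (hε : ε ∈ Set.Ioo (0 : ℝ) 1) (hδ : δ ∈ Set.Ioo (0 : ℝ) 1)
    (hK : 1 ≤ K) :
    Real.sqrt (logTerm goodConstants K M.γ ε δ / outerBatch goodConstants K M.γ ε δ)
      * Real.sqrt (1 - M.γ)⁻¹ ^ 3 ≤ ε / 10 ^ 4 := by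
  have hm := le_outerBatch (K := K) (γ := M.γ) (ε := ε) (δ := δ)
  have hH := one_le_inv_one_sub M.γ_mem
  have hℓ := one_le_logTerm M.γ_mem hε hδ hK
  have hℓ2 := logTerm_le_rpow M.γ_mem hε hδ hK
  set H := (1 - M.γ)⁻¹
  set ℓ := logTerm goodConstants K M.γ ε δ
  set m : ℝ := (outerBatch goodConstants K M.γ ε δ : ℝ)
  have hε0 := hε.1
  have h1 : 10 ^ 8 * (1 / ε ^ 2) * (ℓ * H ^ 3) ≤ m := le_trans (by gcongr) hm
  have hm0 : 0 < m := lt_of_lt_of_le (by positivity) h1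
  rw [← Real.sqrt_sq (show 0 ≤ Real.sqrt H ^ 3 by positivity), ← Real.sqrt_mul (by positivity),
    Real.sqrt_le_iff]
  refine ⟨by positivity, ?_⟩
  have h2 : (Real.sqrt H ^ 3) ^ 2 = H ^ 3 := by
    rw [← pow_mul, mul_comm, pow_mul, Real.sq_sqrt (by linarith)]
  rw [h2, div_mul_eq_mul_div, div_le_iff₀ hm0]
  have h4 : ℓ * H ^ 3 = (ε / 10 ^ 4) ^ 2 * (10 ^ 8 * (1 / ε ^ 2) * (ℓ * H ^ 3)) := by
    field_simp
  rw [h4]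
  gcongr

lemma sqrt_innerBatch_le (hℓ : 1 ≤ logTerm goodConstants K M.γ ε δ) :
    Real.sqrt (logTerm goodConstants K M.γ ε δ / innerBatch goodConstants K M.γ ε δ)
      * (1 - M.γ)⁻¹ ≤ 1 / 10 ^ 4 := by
  have hm := le_innerBatch (K := K) (γ := M.γ) (ε := ε) (δ := δ)
  have hH := one_le_inv_one_sub M.γ_mem
  set H := (1 - M.γ)⁻¹
  set ℓ := logTerm goodConstants K M.γ ε δ
  set m : ℝ := (innerBatch goodConstants K M.γ ε δ : ℝ)
  have hm0 : 0 < m := lt_of_lt_of_le (by positivity) hm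
  rw [← Real.sqrt_sq (show 0 ≤ H by linarith), ← Real.sqrt_mul (by positivity),
    Real.sqrt_le_iff]
  refine ⟨by positivity, ?_⟩
  rw [div_mul_eq_mul_div, div_le_iff₀ hm0]
  nlinarith

end Batches

/-! ### Convergence on accurate samples -/

section Convergence

variable {S A : Type*} [Fintype S] [Finite A] [Nonempty A] {M : MDP S A} {d K : ℕ}
  {φ : S → A → Fin d → ℝ} {anchor : Fin K → S × A} {lam : S → A → Fin K → ℝ} {ε δ : ℝ}

/-- The unshifted estimate is within e + o of the true mean; subtracting e + o puts it below the
mean at a loss of at most 2(e + o). Clipping is harmless because the mean lies in [0, H]. -/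
lemma newParam_bound {c : Constants} (hl : IsAnchorCombination φ anchor lam)
    {θ₀ θ : Finset (Fin K → ℝ)} (hθ : InRange M.γ θ) (p : PMF S) (i : ℕ)
    (x₀ : Fin K → Fin (outerBatch c K M.γ ε δ) → S)
    (x : Fin K → Fin (innerBatch c K M.γ ε δ) → S) (k : Fin K) {e o : ℝ}
    (he : e = refErr c M.r M.γ lam ε δ θ₀ (x₀ k))
    (ho : o = c.cOff * (1 - M.γ)⁻¹ * (1 / 2) ^ i *
      Real.sqrt (logTerm c K M.γ ε δ / innerBatch c K M.γ ε δ))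
    (h0 : |refMean M.r M.γ lam θ₀ (x₀ k) - expect p (paramV M.r M.γ lam θ₀)| ≤ e)
    (h1 : |empMean (fun s => paramV M.r M.γ lam θ s - paramV M.r M.γ lam θ₀ s) (x k)
      - expect p fun s => paramV M.r M.γ lam θ s - paramV M.r M.γ lam θ₀ s| ≤ o) :
    newParam c M.r M.γ lam ε δ i θ₀ x₀ θ x k ≤ expect p (paramV M.r M.γ lam θ) ∧
      expect p (paramV M.r M.γ lam θ) - 2 * (e + o)
        ≤ newParam c M.r M.γ lam ε δ i θ₀ x₀ θ x k := by
  have hV := fun s => paramV_mem hl hθ s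
  have hμ0 := expect_nonneg p fun s => (hV s).1
  have hμ1 := expect_le p fun s => (hV s).2
  have he0 := (abs_nonneg _).trans h0
  have ho0 := (abs_nonneg _).trans h1
  rw [expect_sub] at h1
  have h0' := abs_le.mp h0
  have h1' := abs_le.mp h1
  simp only [newParam, ← he, ← ho]
  constructor
  · refine max_le hμ0 ((min_le_left _ _).trans ?_)
    change _ ≤ expect p fun s => paramV M.r M.γ lam θ s
    linarith
  · refine le_max_of_le_right (le_min ?_ ?_)
    · change (expect p fun s => paramV M.r M.γ lam θ s) - _ ≤ _
      linarith
    · change (expect p fun s => paramV M.r M.γ lam θ s) - _ ≤ _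
      linarith

/-- All the empirical moments that the algorithm uses are accurate. -/
structure AccurateSamples (M : MDP S A) (anchor : Fin K → S × A) (lam : S → A → Fin K → ℝ)
    (ε δ : ℝ) (ω : Query goodConstants K M.γ ε δ → S) : Prop where
  ref : ∀ (i : Fin (numOuter goodConstants M.γ ε + 1)) (k : Fin K),
    AccurateMoments (M.P (anchor k).1 (anchor k).2)
      (paramV M.r M.γ lam (outerLoop goodConstants M.r M.γ lam ε δ ω i i.2.le))
      (1 - M.γ)⁻¹ (4 * logTerm goodConstants K M.γ ε δ) fun l => ω (i, k, Sum.inl l)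
  -- The range [0, B] is a premise, since it holds only when the earlier estimates were accurate;
  -- the convergence induction discharges it.
  off : ∀ (i : Fin (numOuter goodConstants M.γ ε + 1)) (j : Fin (numInner goodConstants M.γ ε))
    (k : Fin K) (f : S → ℝ),
    (f = fun s => paramV M.r M.γ lam (innerLoop goodConstants M.r M.γ lam ε δ ω i
        (outerLoop goodConstants M.r M.γ lam ε δ ω i i.2.le) j j.2.le) s
      - paramV M.r M.γ lam (outerLoop goodConstants M.r M.γ lam ε δ ω i i.2.le) s) →
    (∀ s, f s ∈ Set.Icc 0 ((1 / 2) ^ (i : ℕ) * (1 - M.γ)⁻¹)) →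
    |empMean f (fun l => ω (i, k, Sum.inr (j, l))) - expect (M.P (anchor k).1 (anchor k).2) f|
      ≤ 4 * ((1 / 2) ^ (i : ℕ) * (1 - M.γ)⁻¹) *
        Real.sqrt (4 * logTerm goodConstants K M.γ ε δ / innerBatch goodConstants K M.γ ε δ)

/-- Transfers the deviation from V_{θ₀} to v*, to which the total variance bound applies; 3/2
replaces √2. -/
lemma sqrt_variance_le (p : PMF S) {f g : S → ℝ} {b : ℝ} (hb : 0 ≤ b)
    (h : ∀ s, g s - f s ∈ Set.Icc 0 b) :
    Real.sqrt (variance p f) ≤ 3 / 2 * (Real.sqrt (variance p g) + b) := by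
  have h1 : f = fun s => g s + -(g s - f s) := by funext s; ring
  have h2 := variance_add_le p g fun s => -(g s - f s)
  rw [← h1, variance_neg p fun s => g s - f s] at h2
  have h3 := variance_le_sq p h
  have hg := variance_nonneg p g
  rw [Real.sqrt_le_iff]
  refine ⟨by positivity, ?_⟩
  have h4 := Real.sq_sqrt hg
  nlinarith [mul_nonneg (Real.sqrt_nonneg (variance p g)) hb, sq_nonneg b]

/-- On accurate samples an outer iteration halves the error. -/
lemma AccurateSamples.innerLoop_halves {ω : Query goodConstants K M.γ ε δ → S}
    (hω : AccurateSamples M anchor lam ε δ ω) (hφ : M.AdmitsFeatures φ)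
    (hl : IsAnchorCombination φ anchor lam) (hε : ε ∈ Set.Ioo (0 : ℝ) 1)
    (hδ : δ ∈ Set.Ioo (0 : ℝ) 1) (hK : 1 ≤ K)
    (i : Fin (numOuter goodConstants M.γ ε + 1)) {θ₀ : Finset (Fin K → ℝ)}
    (hθ₀ : θ₀ = outerLoop goodConstants M.r M.γ lam ε δ ω i i.2.le)
    (hU : Underestimates M anchor lam θ₀)
    (hD : ∀ s, M.optValue s - paramV M.r M.γ lam θ₀ s ≤ (1 / 2) ^ (i : ℕ) * (1 - M.γ)⁻¹) :
    Underestimates M anchor lam (innerLoop goodConstants M.r M.γ lam ε δ ω i θ₀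
        (numInner goodConstants M.γ ε) le_rfl) ∧
      ∀ s, M.optValue s - paramV M.r M.γ lam (innerLoop goodConstants M.r M.γ lam ε δ ω i θ₀
        (numInner goodConstants M.γ ε) le_rfl) s ≤ (1 / 2) ^ ((i : ℕ) + 1) * (1 - M.γ)⁻¹ := by
  obtain ⟨π, hπ⟩ := M.exists_optimal
  have hℓ := one_le_logTerm M.γ_mem hε hδ hK
  have hm := le_outerBatch' M.γ_mem hε hδ hK
  have hH := one_le_inv_one_sub M.γ_mem
  have hγ1 := M.one_sub_γ_pos
  have hγ0 := M.γ_pos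
  have hεB := eps_le_half_pow M.γ_mem hε (Nat.lt_succ_iff.mp i.2)
  have hq := sqrt_outerBatch_le (M := M) hε hδ hK
  have hρ := inv_rpow_outerBatch_le (M := M) (K := K) (δ := δ) hε hℓ
  have hq1 := sqrt_innerBatch_le (M := M) (K := K) (ε := ε) (δ := δ) hℓ
  have hR₀ : InRange M.γ θ₀ := hθ₀ ▸ inRange_outerLoop hγ1 ω i i.2.le
  have hB0 : 0 ≤ (1 / 2 : ℝ) ^ (i : ℕ) * (1 - M.γ)⁻¹ := by positivity
  have hBexp : 8 * (1 - M.γ)⁻¹ * (1 / 2) ^ (i : ℕ) = 8 * ((1 / 2 : ℝ) ^ (i : ℕ) * (1 - M.γ)⁻¹) := by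
    ring
  have hBsucc : (1 / 2 : ℝ) ^ ((i : ℕ) + 1) * (1 - M.γ)⁻¹
      = (1 / 2 : ℝ) ^ (i : ℕ) * (1 - M.γ)⁻¹ / 2 := by
    rw [pow_succ]
    ring
  set H := (1 - M.γ)⁻¹ with hHdef
  set B := (1 / 2 : ℝ) ^ (i : ℕ) * H with hB
  set q := Real.sqrt (logTerm goodConstants K M.γ ε δ / outerBatch goodConstants K M.γ ε δ)
    with hqdef
  set q1 := Real.sqrt (logTerm goodConstants K M.γ ε δ / innerBatch goodConstants K M.γ ε δ)
    with hq1def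
  set ρ := logTerm goodConstants K M.γ ε δ * H
    / (outerBatch goodConstants K M.γ ε δ : ℝ) ^ (3 / 4 : ℝ) with hρdef
  have hρ' : ρ * H ≤ ε / 10 ^ 6 := by
    refine le_trans (le_of_eq ?_) hρ
    rw [hρdef]
    ring
  have hq0 : 0 ≤ q := Real.sqrt_nonneg _
  have hq10 : 0 ≤ q1 := Real.sqrt_nonneg _
  have hρ0 : 0 ≤ ρ := by positivity
  -- This choice makes xH and 2H²/x both of order H^{3/2}.
  set x := Real.sqrt H with hxdef
  have hxx : x ^ 2 = H := Real.sq_sqrt (by linarith)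
  have hx1 : 1 ≤ x := Real.one_le_sqrt.mpr hH
  have hx0 : 0 < x := by linarith
  -- 48 = 32·3/2 comes from `refErr_bound` and `sqrt_variance_le`, 192 = 32·6 from the m^{-3/4}
  -- term, and 8Bq₁ is the offset error.
  set α := 48 * q with hα
  set β := 48 * q * B + 192 * ρ + 8 * B * q1 with hβ
  have hα0 : 0 ≤ α := by positivity
  have hβ0 : 0 ≤ β := by positivity
  have href := fun k => refErr_bound hl hR₀ (M.P (anchor k).1 (anchor k).2) hℓ hm
    (by rw [hθ₀]; exact hω.ref i k)
  have herr : ∀ k, refErr goodConstants M.r M.γ lam ε δ θ₀ (fun l => ω (i, k, Sum.inl l))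
      + 8 * B * q1
      ≤ α * Real.sqrt (variance (M.P (anchor k).1 (anchor k).2) (M.value π)) + β := fun k => by
    have h1 := (href k).2
    have h2 := sqrt_variance_le (M.P (anchor k).1 (anchor k).2) (f := paramV M.r M.γ lam θ₀)
      (g := M.value π) hB0 fun s => by
        rw [← hπ s]
        exact ⟨sub_nonneg.mpr (hU.paramV_le_optValue hφ hl hR₀.1 s), hD s⟩
    have h3 := mul_le_mul_of_nonneg_left h2 hq0
    rw [hα, hβ]
    linarith
  have main : ∀ (j : ℕ) (hj : j ≤ numInner goodConstants M.γ ε),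
      Underestimates M anchor lam (innerLoop goodConstants M.r M.γ lam ε δ ω i θ₀ j hj) ∧
      ∀ s, M.value π s - paramV M.r M.γ lam
        (innerLoop goodConstants M.r M.γ lam ε δ ω i θ₀ j hj) s
          ≤ M.γ ^ j * B + M.varianceBound π α β x s := by
    intro j
    induction j with
    | zero =>
      refine fun hj => ⟨hU, fun s => ?_⟩
      have h1 := M.varianceBound_nonneg π hα0 hβ0 hx0 s
      have h2 := hD s
      rw [hπ s] at h2
      simp only [innerLoop, pow_zero, one_mul]
      linarith
    | succ j ih =>
      intro hj
      obtain ⟨hUj, hDj⟩ := ih (Nat.le_of_succ_le hj)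
      have hRj := hR₀.innerLoop (lam := lam) (r := M.r) hγ1 ω i j (Nat.le_of_succ_le hj)
      have hsub := subset_innerLoop (r := M.r) (lam := lam) ω i θ₀ j (Nat.le_of_succ_le hj)
      set θ := innerLoop goodConstants M.r M.γ lam ε δ ω i θ₀ j (Nat.le_of_succ_le hj) with hθ
      have hoff := fun k => hω.off i ⟨j, hj⟩ k
        (fun s => paramV M.r M.γ lam θ s - paramV M.r M.γ lam θ₀ s) (by rw [hθ, hθ₀]) fun s =>
          ⟨sub_nonneg.mpr (paramV_mono hR₀.1 hsub s), by
            have := hUj.paramV_le_optValue hφ hl hRj.1 s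
            linarith [hD s]⟩
      have hbound := fun k => newParam_bound (θ₀ := θ₀) hl hRj (M.P (anchor k).1 (anchor k).2) i
        (fun k l => ω (i, k, Sum.inl l)) (fun k l => ω (i, k, Sum.inr (⟨j, hj⟩, l))) k
        (o := 8 * B * q1) rfl (by rw [← hBexp]; rfl) (href k).1 ((hoff k).trans_eq (by
          rw [mul_div_assoc, Real.sqrt_mul (by norm_num),
            show (4 : ℝ) = 2 ^ 2 by norm_num, Real.sqrt_sq (by norm_num)]
          ring))
      refine ⟨hUj.insert hRj.1 fun k => (hbound k).1, fun s => ?_⟩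
      have := value_sub_paramV_insert_le hφ hl hα0 hβ0 hx0
        (fun k => le_trans (by linarith [herr k]) (hbound k).2) hDj s
      rw [pow_succ, mul_comm (M.γ ^ j), mul_assoc]
      exact this
  obtain ⟨hUR, hDR⟩ := main _ le_rfl
  refine ⟨hUR, fun s => ?_⟩
  rw [hπ s, hBsucc]
  refine (hDR s).trans ?_
  -- One quarter of B remains from the start. The accumulated errors are small multiples of ε and B,
  -- and ε ≤ 2B keeps them below another quarter.
  have h1 : M.γ ^ numInner goodConstants M.γ ε * B ≤ 1 / 4 * B :=
    mul_le_mul_of_nonneg_right (pow_numInner_le M.γ_mem hε) hB0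
  have h2 := M.varianceBound_le π (β := β) hα0 hx0 s
  have h3 : x * H + 2 * H ^ 2 / x = 3 * x ^ 3 := by
    rw [← hxx]
    field_simp
    ring
  rw [← hHdef, h3] at h2
  have h4 : α * (3 * x ^ 3) ≤ 144 * (ε / 10 ^ 4) := by
    rw [hα]
    linarith
  have h5 : q * H ≤ 1 / 10 ^ 4 := by
    have e1 : q * H ≤ q * x ^ 3 := by
      rw [← hxx]
      exact mul_le_mul_of_nonneg_left (pow_le_pow_right₀ hx1 (by norm_num)) hq0
    linarith [hε.2]
  have h6 : 2 * β * H = 96 * B * (q * H) + 384 * (ρ * H) + 16 * B * (q1 * H) := by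
    rw [hβ]
    ring
  have h7 := mul_le_mul_of_nonneg_left h5 hB0
  have h8 := mul_le_mul_of_nonneg_left hq1 hB0
  linarith

lemma AccurateSamples.outerLoop_error {ω : Query goodConstants K M.γ ε δ → S}
    (hω : AccurateSamples M anchor lam ε δ ω) (hφ : M.AdmitsFeatures φ)
    (hl : IsAnchorCombination φ anchor lam) (hε : ε ∈ Set.Ioo (0 : ℝ) 1)
    (hδ : δ ∈ Set.Ioo (0 : ℝ) 1) (hK : 1 ≤ K) (i : ℕ)
    (hi : i ≤ numOuter goodConstants M.γ ε + 1) :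
    Underestimates M anchor lam (outerLoop goodConstants M.r M.γ lam ε δ ω i hi) ∧
      ∀ s, M.optValue s - paramV M.r M.γ lam (outerLoop goodConstants M.r M.γ lam ε δ ω i hi) s
        ≤ (1 / 2) ^ i * (1 - M.γ)⁻¹ := by
  induction i with
  | zero =>
    have hR := inRange_outerLoop (r := M.r) (lam := lam) M.one_sub_γ_pos ω 0 hi
    refine ⟨fun w hw k => ?_, fun s => ?_⟩
    · rw [Finset.mem_singleton.mp hw]
      exact expect_nonneg _ fun s => (paramV_mem hl hR s).1
    · obtain ⟨π, hπ⟩ := M.exists_optimal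
      rw [hπ s, pow_zero, one_mul]
      linarith [(M.value_mem π s).2, (paramV_mem hl hR s).1]
  | succ i ih =>
    obtain ⟨hU, hD⟩ := ih (Nat.le_of_succ_le hi)
    exact hω.innerLoop_halves hφ hl hε hδ hK ⟨i, hi⟩ rfl hU hD

/-- On accurate samples every policy `π_θ` of the output is `ε`-optimal. -/
lemma AccurateSamples.isEpsOptimal {ω : Query goodConstants K M.γ ε δ → S}
    (hω : AccurateSamples M anchor lam ε δ ω) (hφ : M.AdmitsFeatures φ)
    (hl : IsAnchorCombination φ anchor lam) (hε : ε ∈ Set.Ioo (0 : ℝ) 1)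
    (hδ : δ ∈ Set.Ioo (0 : ℝ) 1) (hK : 1 ≤ K) {π : S → A}
    (hπ : IsParamPolicy M.r M.γ lam (output goodConstants M.r M.γ lam ε δ ω) π) :
    M.IsEpsOptimal ε π := by
  intro s
  obtain ⟨hU, hD⟩ := hω.outerLoop_error hφ hl hε hδ hK _ le_rfl
  have h1 := hU.paramV_le_value hφ hl
    (inRange_outerLoop M.one_sub_γ_pos ω _ le_rfl).1 hπ s
  have h2 := hD s
  have h3 := half_pow_numOuter_le M.γ_mem hε
  have h4 : 0 ≤ (1 / 2 : ℝ) ^ numOuter goodConstants M.γ ε * (1 - M.γ)⁻¹ :=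
    mul_nonneg (by positivity) (inv_pos.mpr M.one_sub_γ_pos).le
  rw [pow_succ] at h2
  linarith

end Convergence

/-! ### The probability of inaccurate samples -/

section Probability

variable {S : Type*} [Fintype S] [MeasurableSpace S] [MeasurableSingletonClass S]

lemma measure_not_accurateMoments_le (p : PMF S) {f : S → ℝ} {H L : ℝ} {n : ℕ} (hn : 0 < n)
    (hH : 0 < H) (hL : 0 ≤ L) (hLn : L ≤ n) (hf : ∀ s, f s ∈ Set.Icc 0 H) :
    (Measure.pi fun _ : Fin n => p.toMeasure).real {x | ¬ AccurateMoments p f H L x}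
      ≤ 6 * Real.exp (-L) := by
  have h1 := bernstein p hn hH hL (abs_sub_expect_le p hf)
  have h2 := bernstein_range p hn hH hL hLn hf
  have h3 := bernstein_range p (f := fun s => f s ^ 2) (b := H ^ 2) hn (by positivity) hL hLn
    fun s => ⟨sq_nonneg _, pow_le_pow_left₀ (hf s).1 (hf s).2 2⟩
  have h4 := (measureReal_union_le _ _).trans (add_le_add h1 ((measureReal_union_le _ _).trans
    (add_le_add h2 h3)))
  refine (measureReal_mono ?_ (measure_ne_top _ _)).trans (h4.trans_eq (by ring))
  intro x hx
  simp only [Set.mem_ofPred_eq, AccurateMoments, not_and_or, not_le] at hx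
  simpa only [Set.mem_union, Set.mem_ofPred_eq] using hx

instance isProbabilityMeasure_sampleLaw {A : Type*} {K : ℕ} (c : Constants) (M : MDP S A) (anchor : Fin K → S × A) (ε δ : ℝ) :
    IsProbabilityMeasure (sampleLaw c M anchor ε δ) := by
  unfold sampleLaw
  infer_instance

variable {A : Type*} {M : MDP S A} {d K : ℕ} {φ : S → A → Fin d → ℝ}
  {anchor : Fin K → S × A} {lam : S → A → Fin K → ℝ} {ε δ : ℝ}

/-- The tested function does not see batch `j`, so it may be frozen; when it violates the range
condition the bad set is empty. -/
lemma measure_off_le (hε : ε ∈ Set.Ioo (0 : ℝ) 1)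
    (hδ : δ ∈ Set.Ioo (0 : ℝ) 1) (hK : 1 ≤ K)
    (i : Fin (numOuter goodConstants M.γ ε + 1)) (j : Fin (numInner goodConstants M.γ ε))
    (k : Fin K) :
    (sampleLaw goodConstants M anchor ε δ).real
      {ω | ¬ ∀ f : S → ℝ,
        (f = fun s => paramV M.r M.γ lam (innerLoop goodConstants M.r M.γ lam ε δ ω i
            (outerLoop goodConstants M.r M.γ lam ε δ ω i i.2.le) j j.2.le) s
          - paramV M.r M.γ lam (outerLoop goodConstants M.r M.γ lam ε δ ω i i.2.le) s) →
        (∀ s, f s ∈ Set.Icc 0 ((1 / 2) ^ (i : ℕ) * (1 - M.γ)⁻¹)) →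
        |empMean f (fun l => ω (i, k, Sum.inr (j, l))) - expect (M.P (anchor k).1 (anchor k).2) f|
          ≤ 4 * ((1 / 2) ^ (i : ℕ) * (1 - M.γ)⁻¹) * Real.sqrt
            (4 * logTerm goodConstants K M.γ ε δ / innerBatch goodConstants K M.γ ε δ)}
      ≤ 2 * Real.exp (-(4 * logTerm goodConstants K M.γ ε δ)) := by
  have hℓ := one_le_logTerm M.γ_mem hε hδ hK
  have hm := le_innerBatch' M.γ_mem hε hδ hK
  have hm0 : 0 < innerBatch goodConstants K M.γ ε δ := by
    rw [← Nat.cast_pos (α := ℝ)]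
    linarith
  have hγ := M.one_sub_γ_pos
  let e : Fin (innerBatch goodConstants K M.γ ε δ) → Query goodConstants K M.γ ε δ :=
    fun l => (i, k, Sum.inr (j, l))
  have he : Function.Injective e := fun l l' h => by simpa [e] using h
  let F : (Query goodConstants K M.γ ε δ → S) → S → ℝ := fun ω s =>
    paramV M.r M.γ lam (innerLoop goodConstants M.r M.γ lam ε δ ω i
        (outerLoop goodConstants M.r M.γ lam ε δ ω i i.2.le) j j.2.le) s
      - paramV M.r M.γ lam (outerLoop goodConstants M.r M.γ lam ε δ ω i i.2.le) s
  let bad : (S → ℝ) → Set (Fin (innerBatch goodConstants K M.γ ε δ) → S) := fun f =>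
    {x | ¬ ((∀ s, f s ∈ Set.Icc 0 ((1 / 2) ^ (i : ℕ) * (1 - M.γ)⁻¹)) →
      |empMean f x - expect (M.P (anchor k).1 (anchor k).2) f|
        ≤ 4 * ((1 / 2) ^ (i : ℕ) * (1 - M.γ)⁻¹) * Real.sqrt
          (4 * logTerm goodConstants K M.γ ε δ / innerBatch goodConstants K M.γ ε δ))}
  have h := measure_pi_batch_le
    (fun q : Query goodConstants K M.γ ε δ => (M.P (anchor q.2.1).1 (anchor q.2.1).2).toMeasure)
    he F (fun ω ω' h => by
      have h0 : outerLoop goodConstants M.r M.γ lam ε δ ω i i.2.le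
          = outerLoop goodConstants M.r M.γ lam ε δ ω' i i.2.le :=
        outerLoop_congr i i.2.le fun q hq => h q (by
          rintro ⟨l, rfl⟩
          exact lt_irrefl _ hq)
      have h1 : ∀ θ₀, innerLoop goodConstants M.r M.γ lam ε δ ω i θ₀ j j.2.le
          = innerLoop goodConstants M.r M.γ lam ε δ ω' i θ₀ j j.2.le := fun θ₀ =>
        innerLoop_congr i θ₀ j j.2.le
          (fun k' l => h _ (by
            rintro ⟨l', hl'⟩
            simp [e] at hl'))
          (fun k' j' l hlt => h _ (by
            rintro ⟨l', hl'⟩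
            simp only [e, Prod.mk.injEq, Sum.inr.injEq] at hl'
            rw [hl'.2.2.1] at hlt
            exact lt_irrefl _ hlt))
      simp only [F, h0, h1])
    bad (c := 2 * Real.exp (-(4 * logTerm goodConstants K M.γ ε δ))) fun f => by
      by_cases hf : ∀ s, f s ∈ Set.Icc 0 ((1 / 2) ^ (i : ℕ) * (1 - M.γ)⁻¹)
      · have := bernstein_range (M.P (anchor k).1 (anchor k).2) hm0
          (show 0 < (1 / 2) ^ (i : ℕ) * (1 - M.γ)⁻¹ by positivity) (by linarith) hm hf
        refine (measureReal_mono ?_ (measure_ne_top _ _)).trans this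
        intro x hx
        simp only [bad, Set.mem_ofPred_eq] at hx ⊢
        exact not_le.mp fun hle => hx fun _ => hle
      · have hempty : bad f = ∅ := by
          ext x
          simp only [bad, hf, false_imp_iff, not_true_eq_false, Set.mem_ofPred_eq,
            Set.mem_empty_iff_false]
        rw [hempty, measureReal_empty]
        positivity
  refine (measureReal_mono ?_ (measure_ne_top _ _)).trans h
  intro ω hω
  simp only [Set.mem_ofPred_eq] at hω
  simp only [bad, Set.mem_ofPred_eq]
  exact fun hgood => hω fun f hf => hf ▸ hgood

variable [Finite A] [Nonempty A]

lemma measure_ref_le (hl : IsAnchorCombination φ anchor lam) (hε : ε ∈ Set.Ioo (0 : ℝ) 1)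
    (hδ : δ ∈ Set.Ioo (0 : ℝ) 1) (hK : 1 ≤ K)
    (i : Fin (numOuter goodConstants M.γ ε + 1)) (k : Fin K) :
    (sampleLaw goodConstants M anchor ε δ).real
      {ω | ¬ AccurateMoments (M.P (anchor k).1 (anchor k).2)
        (paramV M.r M.γ lam (outerLoop goodConstants M.r M.γ lam ε δ ω i i.2.le))
        (1 - M.γ)⁻¹ (4 * logTerm goodConstants K M.γ ε δ) fun l => ω (i, k, Sum.inl l)}
      ≤ 6 * Real.exp (-(4 * logTerm goodConstants K M.γ ε δ)) := by
  have hℓ := one_le_logTerm M.γ_mem hε hδ hK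
  have hm := le_outerBatch' M.γ_mem hε hδ hK
  have hm0 : 0 < outerBatch goodConstants K M.γ ε δ := by
    rw [← Nat.cast_pos (α := ℝ)]
    linarith
  let e : Fin (outerBatch goodConstants K M.γ ε δ) → Query goodConstants K M.γ ε δ :=
    fun l => (i, k, Sum.inl l)
  have he : Function.Injective e := fun l l' h => by simpa [e] using h
  have hrange := fun ω => inRange_outerLoop (c := goodConstants) (r := M.r) (lam := lam)
    (ε := ε) (δ := δ) M.one_sub_γ_pos ω i i.2.le
  let F : (Query goodConstants K M.γ ε δ → S) → S → ℝ := fun ω =>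
    paramV M.r M.γ lam (outerLoop goodConstants M.r M.γ lam ε δ ω i i.2.le)
  let bad : (S → ℝ) → Set (Fin (outerBatch goodConstants K M.γ ε δ) → S) := fun f =>
    {x | ¬ ((∀ s, f s ∈ Set.Icc 0 (1 - M.γ)⁻¹) →
      AccurateMoments (M.P (anchor k).1 (anchor k).2) f (1 - M.γ)⁻¹
        (4 * logTerm goodConstants K M.γ ε δ) x)}
  have h := measure_pi_batch_le
    (fun q : Query goodConstants K M.γ ε δ => (M.P (anchor q.2.1).1 (anchor q.2.1).2).toMeasure)
    he F (fun ω ω' h => by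
      have h0 : outerLoop goodConstants M.r M.γ lam ε δ ω i i.2.le
          = outerLoop goodConstants M.r M.γ lam ε δ ω' i i.2.le :=
        outerLoop_congr i i.2.le fun q hq => h q (by
          rintro ⟨l, rfl⟩
          exact lt_irrefl _ hq)
      simp only [F, h0])
    bad (c := 6 * Real.exp (-(4 * logTerm goodConstants K M.γ ε δ))) fun f => by
      by_cases hf : ∀ s, f s ∈ Set.Icc 0 (1 - M.γ)⁻¹
      · have := measure_not_accurateMoments_le (M.P (anchor k).1 (anchor k).2) hm0
          (inv_pos.mpr M.one_sub_γ_pos) (by linarith) hm hf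
        refine (measureReal_mono ?_ (measure_ne_top _ _)).trans this
        intro x hx
        simp only [bad, Set.mem_ofPred_eq] at hx ⊢
        exact fun hle => hx fun _ => hle
      · have hempty : bad f = ∅ := by
          ext x
          simp only [bad, hf, false_imp_iff, not_true_eq_false, Set.mem_ofPred_eq,
            Set.mem_empty_iff_false]
        rw [hempty, measureReal_empty]
        positivity
  refine (measureReal_mono ?_ (measure_ne_top _ _)).trans h
  intro ω hω
  simp only [Set.mem_ofPred_eq] at hω
  simp only [bad, Set.mem_ofPred_eq]
  exact fun hgood => hω (hgood fun s => paramV_mem hl (hrange ω) s)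

/-- The union bound: each reference batch costs 6e^{-4ℓ}, each inner batch 2e^{-4ℓ}. With T = R'RK ≥
4 the total is at most 8T(δ/T)⁴ = 8δ(δ/T)³ ≤ δ; the exponent 4ℓ absorbs the constants. -/
lemma exp_neg_logTerm {γ : ℝ} (hγ : γ ∈ Set.Ioo (0 : ℝ) 1) (hε : ε ∈ Set.Ioo (0 : ℝ) 1)
    (hδ : δ ∈ Set.Ioo (0 : ℝ) 1) (hK : 1 ≤ K) :
    (numOuter goodConstants γ ε + 1) * (K * (6 + numInner goodConstants γ ε * 2)) *
      Real.exp (-(4 * logTerm goodConstants K γ ε δ)) ≤ δ := by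
  have h1 : (1 : ℝ) ≤ numOuter goodConstants γ ε := by exact_mod_cast one_le_numOuter hγ hε
  have h2 := four_le_numInner hγ hε
  have h3 : (1 : ℝ) ≤ K := by exact_mod_cast hK
  have hpos := logTerm_arg_pos hγ hε hδ hK
  have hδ0 := hδ.1
  have h4 : Real.exp (-(4 * logTerm goodConstants K γ ε δ))
      = (δ / (numOuter goodConstants γ ε * numInner goodConstants γ ε * K)) ^ 4 := by
    rw [Real.exp_neg, show 4 * logTerm goodConstants K γ ε δ
      = (4 : ℕ) * logTerm goodConstants K γ ε δ by norm_num, Real.exp_nat_mul, logTerm,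
      Real.exp_log hpos, ← inv_pow, inv_div]
  rw [h4]
  generalize (numOuter goodConstants γ ε : ℝ) = a at *
  generalize (numInner goodConstants γ ε : ℝ) = b at *
  set T := a * b * K with hT
  have hT4 : 4 ≤ T := by
    have : 4 ≤ a * b := by nlinarith
    nlinarith
  have h5 : (a + 1) * (K * (6 + b * 2)) ≤ 8 * T := by
    have e1 : (a + 1) * (K * (6 + b * 2)) ≤ (2 * a) * (K * (4 * b)) := by
      gcongr
      · linarith
      · linarith
    linarith
  have h6 : δ / T ≤ 1 / 4 := by
    rw [div_le_div_iff₀ (by linarith) (by norm_num)]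
    linarith [hδ.2]
  have h7 : 0 ≤ δ / T := by positivity
  have h8 : (δ / T) ^ 3 ≤ (1 / 4) ^ 3 := pow_le_pow_left₀ h7 h6 3
  calc (a + 1) * (K * (6 + b * 2)) * (δ / T) ^ 4 ≤ 8 * T * (δ / T) ^ 4 := by gcongr
    _ = 8 * δ * (δ / T) ^ 3 := by
        have : T ≠ 0 := by linarith
        field_simp
    _ ≤ 8 * δ * (1 / 4) ^ 3 := by gcongr
    _ ≤ δ := by linarith

lemma measure_not_accurateSamples_le (hl : IsAnchorCombination φ anchor lam)
    (hε : ε ∈ Set.Ioo (0 : ℝ) 1) (hδ : δ ∈ Set.Ioo (0 : ℝ) 1) (hK : 1 ≤ K) :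
    (sampleLaw goodConstants M anchor ε δ).real
      {ω | ¬ AccurateSamples M anchor lam ε δ ω} ≤ δ := by
  have h1 := fun i k => measure_ref_le (M := M) hl hε hδ hK i k
  have h2 := fun i j k => measure_off_le (M := M) (anchor := anchor) (lam := lam) hε hδ hK i j k
  set p := Real.exp (-(4 * logTerm goodConstants K M.γ ε δ)) with hp
  have h3 := fun i k => (measureReal_iUnion_fintype_le _).trans
    (Finset.sum_le_sum fun j (_ : j ∈ Finset.univ) => h2 i j k)
  have h4 := fun i k => (measureReal_union_le _ _).trans (add_le_add (h1 i k) (h3 i k))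
  have h5 := fun i => (measureReal_iUnion_fintype_le _).trans
    (Finset.sum_le_sum fun k (_ : k ∈ Finset.univ) => h4 i k)
  have h6 := (measureReal_iUnion_fintype_le _).trans
    (Finset.sum_le_sum fun i (_ : i ∈ Finset.univ) => h5 i)
  refine (measureReal_mono ?_ (measure_ne_top _ _)).trans (h6.trans ?_)
  · intro ω hω
    by_contra hcon
    simp only [Set.mem_iUnion, Set.mem_union, Set.mem_ofPred_eq, not_exists, not_or,
      not_not] at hcon
    exact hω ⟨fun i k => (hcon i k).1, fun i j k => (hcon i k).2 j⟩
  · simp only [Finset.sum_const, Finset.card_univ, Fintype.card_fin, nsmul_eq_mul]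
    push_cast
    refine le_trans (le_of_eq ?_) (exp_neg_logTerm (K := K) M.γ_mem hε hδ hK)
    rw [← hp]
    ring

lemma le_measure_accurateSamples (hl : IsAnchorCombination φ anchor lam)
    (hε : ε ∈ Set.Ioo (0 : ℝ) 1) (hδ : δ ∈ Set.Ioo (0 : ℝ) 1) (hK : 1 ≤ K) :
    1 - δ ≤ (sampleLaw goodConstants M anchor ε δ).real
      {ω | AccurateSamples M anchor lam ε δ ω} := by
  have h1 := measure_not_accurateSamples_le (M := M) hl hε hδ hK
  have h2 := measureReal_union_le (μ := sampleLaw goodConstants M anchor ε δ)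
    {ω | AccurateSamples M anchor lam ε δ ω} {ω | ¬ AccurateSamples M anchor lam ε δ ω}
  have h3 : {ω | AccurateSamples M anchor lam ε δ ω} ∪ {ω | ¬ AccurateSamples M anchor lam ε δ ω}
      = Set.univ := by
    ext ω
    simp only [Set.mem_union, Set.mem_ofPred_eq, Set.mem_univ, iff_true]
    exact em _
  rw [h3, probReal_univ] at h2
  linarith

end Probability

end OPPQ

end

theorem theorem3 :
    ∃ (c : OPPQ.Constants) (cLow cUp : ℝ), c.Pos ∧ 0 < cLow ∧ 0 < cUp ∧
      ∀ (S : Type*) (A : Type*) [Fintype S] [Nonempty S] [MeasurableSpace S]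
        [MeasurableSingletonClass S] [Fintype A] [Nonempty A]
        (M : OPPQ.MDP S A) (d K : ℕ) (φ : S → A → Fin d → ℝ)
        (anchor : Fin K → S × A) (lam : S → A → Fin K → ℝ) (ε δ : ℝ),
        M.AdmitsFeatures φ →
        OPPQ.IsAnchorCombination φ anchor lam →
        ε ∈ Set.Ioo (0 : ℝ) 1 →
        δ ∈ Set.Ioo (0 : ℝ) 1 →
        -- the number of samples
        ((OPPQ.numSamples c K M.γ ε δ : ℝ) ≤
            cUp * (K / ((1 - M.γ) ^ 3 * ε ^ 2)) *
              (1 + Real.log (K / (ε * δ * (1 - M.γ)))) ^ (4 / 3 : ℝ) *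
              (1 + Real.log (1 / (ε * (1 - M.γ)))) ^ 2 ∧
          cLow * (K / ((1 - M.γ) ^ 3 * ε ^ 2)) *
              (1 + Real.log (K / (δ * (1 - M.γ)))) ^ (4 / 3 : ℝ) *
              (1 + Real.log (1 / (ε * (1 - M.γ)))) ≤
            (OPPQ.numSamples c K M.γ ε δ : ℝ)) ∧
        -- the quality of the output
        1 - δ ≤ (OPPQ.sampleLaw c M anchor ε δ).real
          {samples | ∀ π : S → A,
            OPPQ.IsParamPolicy M.r M.γ lam (OPPQ.output c M.r M.γ lam ε δ samples) π →
              M.IsEpsOptimal ε π} := by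
  refine ⟨OPPQ.goodConstants, 1, 144 * 10 ^ 8, OPPQ.goodConstants_pos, one_pos, by norm_num, ?_⟩
  intro S A _ _ _ _ _ _ M d K φ anchor lam ε δ hφ hl hε hδ
  -- With no anchors the coefficients at any state-action pair would sum to 0.
  have hK : 1 ≤ K := by
    by_contra h
    obtain rfl : K = 0 := by omega
    have := (hl (Classical.arbitrary S) (Classical.arbitrary A)).2.1
    simp at this
  refine ⟨⟨OPPQ.numSamples_le M.γ_mem hε hδ hK, OPPQ.le_numSamples M.γ_mem hε hδ hK⟩, ?_⟩
  refine (OPPQ.le_measure_accurateSamples (M := M) hl hε hδ hK).trans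
    (MeasureTheory.measureReal_mono (fun ω hω => ?_) (MeasureTheory.measure_ne_top _ _))
  rw [Set.mem_ofPred_eq] at hω ⊢
  exact fun π hπ => hω.isEpsOptimal hφ hl hε hδ hK hπ
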